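/- Let $X,Y$ be finite-dimensional Euclidean spaces, $A:X\to Y$ linear, $b\in Y$, $c\in X$, and let $K\subseteq Y$ be a closed convex cone. Consider the conic linear program $$(P)\qquad \sup\{\langle c,x\rangle : b-Ax\in K\},$$ assumed feasible. Write $S^*=\{z:\langle z,x\rangle\ge 0\ \forall x\in S\}$ for the dual cone and $S^\perp$ for the orthogonal complement of the linear span of $S$. A (nonempty) convex subset $F$ of a convex set $C$ is a face of $C$ if every open segment with endpoints in $C$ that meets $F$ has both endpoints in $F$. The cone $K$ is nice if $K^*+E^\perp$ is closed for every face $E$ of $K$. The minimal cone $F_{\min}$ of $(P)$ is the unique face of $K$ that contains $b-Ax$ in its relative interior, where $x$ is in the relative interior of the feasible set of $(P)$. For a convex set $C$ and $x\in C$ let $\operatorname{dir}(x,C)=\{y: x+ty\in C\text{ for some }t>0\}$ and $\tan(x,C)=\operatorname{cl}\operatorname{dir}(x,C)\cap-\operatorname{cl}\operatorname{dir}(x,C)$. Let $L=\{y: A^*y=0,\ \langle b,y\rangle=0\}$, let $\ell_K$ be the number of faces in a longest strictly increasing chain of faces of $K$, and let $\ell=\min\{\ell_K-1,\dim L\}$.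 Let $(EXT_{\rm nice})$ be the system in the variables $(u_i,v_i)_{i=0}^{\ell+1}$ $$(u_0,v_0)=(0,0),\qquad (u_i,v_i)\in K^*\times\tan(u_0+\dots+u_{i-1},K^*)\ (1\le i\le\ell+1),\qquad u_i+v_i\in L\ (1\le i\le\ell).$$ A feasible maximization problem and a minimization problem (the dual) have strong duality if the first is bounded exactly when the dual is feasible, and in that case their optimal values agree and the dual value is attained. If $K$ is nice, then $$F_{\min}^*=\{u_{\ell+1}+v_{\ell+1} : (u_i,v_i)_{i=0}^{\ell+1}\text{ is feasible in }(EXT_{\rm nice})\},$$ and the extended dual $$(D_{\rm ext})\qquad \inf\{\langle b,u_{\ell+1}+v_{\ell+1}\rangle : A^*(u_{\ell+1}+v_{\ell+1})=c,\ (u_i,v_i)_{i=0}^{\ell+1}\text{ is feasible in }(EXT_{\rm nice})\}$$ has strong duality with $(P)$. In particular, let $(P)$ be a feasible semidefinite program $\sup\{\sum_{k=1}^m c_kx_k : b-\sum_{k=1}^m x_ka_k\succeq 0\}$, where $b,a_1,\dots,a_m$ are real symmetric $n\times n$ matrices, $a_1,\dots,a_m$ are linearly independent, and $b$ is not in their linear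 span. With $\langle x,z\rangle=\sum_{i,j}x_{ij}z_{ij}$ and $$\ell=\min\{n,\ n(n+1)/2-m-1\},$$ the semidefinite program $$(D_{\rm ext,SDP})\qquad\begin{array}{rl}\inf&\langle b,u_{\ell+1}+v_{\ell+1}\rangle\\ \text{s.t.}&\langle a_k,u_{\ell+1}+v_{\ell+1}\rangle=c_k,\quad k=1,\dots,m,\\ &\langle a_k,u_i+v_i\rangle=0\ (k=1,\dots,m),\quad \langle b,u_i+v_i\rangle=0,\quad i=1,\dots,\ell,\\ &u_i\succeq0,\quad \begin{pmatrix}u_0+\dots+u_{i-1}&w_i\\ w_i^T&\beta_iI\end{pmatrix}\succeq0,\quad v_i=w_i+w_i^T,\quad i=1,\dots,\ell+1,\\ &w_i\in\mathbb R^{n\times n},\ \beta_i\in\mathbb R,\quad i=1,\dots,\ell+1,\qquad (u_0,v_0)=(0,0)\end{array}$$ has strong duality with $(P)$. If instead $b$ is in the linear span of $a_1,\dots,a_m$, the same holds with $\ell=\min\{n,\ n(n+1)/2-m\}$. -/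

import Mathlib

open scoped Pointwise InnerProductSpace

namespace ConicDual

/-- `F` is a face of the convex set `C`: a nonempty convex subset of `C` such that any open segment
of `C` that meets `F` has both endpoints in `F`. (The empty set is not counted as a face.) -/
structure IsFace {Y : Type*} [AddCommGroup Y] [Module ℝ Y] (C F : Set Y) : Prop where
  convex : Convex ℝ F
  nonempty : F.Nonempty
  extreme : IsExtreme ℝ C F

/-- The set `dir(x, C)` of feasible directions at `x` in `C`. -/
def feasDir {Y : Type*} [AddCommGroup Y] [Module ℝ Y] (x : Y) (C : Set Y) : Set Y :=
  {y | ∃ t : ℝ, 0 < t ∧ x + t • y ∈ C}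

/-- The tangent space `tan(x, C) = cl dir(x, C) ∩ -cl dir(x, C)`. -/
def tangentSpace {Y : Type*} [AddCommGroup Y] [Module ℝ Y] [TopologicalSpace Y]
    (x : Y) (C : Set Y) : Set Y :=
  closure (feasDir x C) ∩ -closure (feasDir x C)

/-- The optimization problems `sup {fP p | p ∈ P}` (with `P` nonempty) and `inf {fD d | d ∈ D}` have
strong duality: the first is bounded iff the second is feasible, and in that case the optimal values
agree and the second one is attained. -/
def StrongDuality {α β : Type*} (P : Set α) (fP : α → ℝ) (D : Set β) (fD : β → ℝ) : Prop :=
  (BddAbove (fP '' P) ↔ D.Nonempty) ∧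
    (D.Nonempty → ∃ val : ℝ, IsLUB (fP '' P) val ∧ IsLeast (fD '' D) val)

section Conic

variable {X Y : Type*} [NormedAddCommGroup X] [InnerProductSpace ℝ X] [FiniteDimensional ℝ X]
  [NormedAddCommGroup Y] [InnerProductSpace ℝ Y] [FiniteDimensional ℝ Y]

/-- The dual cone `S* = {z | ⟪z, x⟫ ≥ 0 for all x ∈ S}`, as a set. -/
def dualCone (S : Set Y) : Set Y := (ProperCone.innerDual S : Set Y)

/-- A closed convex cone `K` is nice if `K* + E^⊥` is closed for every face `E` of `K`. -/
def IsNice (K : ProperCone ℝ Y) : Prop :=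
  ∀ E : Set Y, IsFace (K : Set Y) E →
    IsClosed (dualCone (K : Set Y) + ((Submodule.span ℝ E)ᗮ : Set Y))

/-- The feasible set of `(P)`: `sup ⟪c, x⟫` s.t. `b - A x ∈ K`. -/
def primalFeas (A : X →ₗ[ℝ] Y) (b : Y) (K : ProperCone ℝ Y) : Set X :=
  {x | b - A x ∈ K}

/-- `F` is the minimal cone of `(P)`: the face of `K` that contains `b - A x` in its relative
interior, where `x` is in the relative interior of the feasible set of `(P)`. -/
def IsMinimalCone (A : X →ₗ[ℝ] Y) (b : Y) (K : ProperCone ℝ Y) (F : Set Y) : Prop :=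
  IsFace (K : Set Y) F ∧
    ∃ x ∈ intrinsicInterior ℝ (primalFeas A b K), b - A x ∈ intrinsicInterior ℝ F

/-- The subspace `L = N((A, b)*)`, that is `A* y = 0` and `⟪b, y⟫ = 0`. -/
noncomputable def nullL (A : X →ₗ[ℝ] Y) (b : Y) : Submodule ℝ Y :=
  LinearMap.ker (LinearMap.adjoint A) ⊓ LinearMap.ker (innerₗ Y b)

/-- The length of the longest chain of faces in `K`: the largest number `k` of faces in a strictly
increasing chain. (These numbers are bounded, as the dimension increases along a chain.) -/
noncomputable def faceChainLength (K : ProperCone ℝ Y) : ℕ :=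
  sSup {k : ℕ | ∃ F : Fin k → Set Y, StrictMono F ∧ ∀ i, IsFace (K : Set Y) (F i)}

/-- The number `ℓ = min {ℓ_K - 1, dim L}`. -/
noncomputable def ell (A : X →ₗ[ℝ] Y) (b : Y) (K : ProperCone ℝ Y) : ℕ :=
  min (faceChainLength K - 1) (Module.finrank ℝ (nullL A b))

/-- The feasible set of the extended system: sequences `(u_i, v_i)`, `i = 0, …, ℓ + 1`, with
`(u_0, v_0) = (0, 0)`, `u_i ∈ K*` and `v_i ∈ tan(u_0 + … + u_{i-1}, K*)` for `i = 1, …, ℓ + 1`,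
and `u_i + v_i ∈ L` for `i = 1, …, ℓ`. -/
def extNice (A : X →ₗ[ℝ] Y) (b : Y) (K : ProperCone ℝ Y) (ℓ : ℕ) :
    Set ((Fin (ℓ + 2) → Y) × (Fin (ℓ + 2) → Y)) :=
  {p | p.1 0 = 0 ∧ p.2 0 = 0 ∧
    (∀ i : Fin (ℓ + 2), i ≠ 0 → p.1 i ∈ dualCone (K : Set Y) ∧
      p.2 i ∈ tangentSpace (∑ j ∈ Finset.Iio i, p.1 j) (dualCone (K : Set Y))) ∧
    (∀ i : Fin (ℓ + 2), i ≠ 0 → i ≠ Fin.last (ℓ + 1) → p.1 i + p.2 i ∈ nullL A b)}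

/-- The value `u_{ℓ+1} + v_{ℓ+1}` of the last terms of the two sequences. -/
def lastSum {ℓ : ℕ} (p : (Fin (ℓ + 2) → Y) × (Fin (ℓ + 2) → Y)) : Y :=
  p.1 (Fin.last (ℓ + 1)) + p.2 (Fin.last (ℓ + 1))

/-- The feasible set of the extended dual. -/
noncomputable def extDualFeas (A : X →ₗ[ℝ] Y) (b : Y) (c : X) (K : ProperCone ℝ Y) (ℓ : ℕ) :
    Set ((Fin (ℓ + 2) → Y) × (Fin (ℓ + 2) → Y)) :=
  {p | LinearMap.adjoint A (lastSum p) = c ∧ p ∈ extNice A b K ℓ}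

end Conic

section SDP

/-- The inner product `⟨x, z⟩ = ∑_{i,j} x_{ij} z_{ij}` of matrices. -/
def matInner {n : ℕ} (x z : Matrix (Fin n) (Fin n) ℝ) : ℝ := ∑ i, ∑ j, x i j * z i j

/-- The feasible set of the semidefinite program `sup ∑ c_k x_k` s.t. `b - ∑ x_k a_k ⪰ 0`. -/
def sdpFeas {n m : ℕ} (a : Fin m → Matrix (Fin n) (Fin n) ℝ) (b : Matrix (Fin n) (Fin n) ℝ) :
    Set (Fin m → ℝ) :=
  {x | (b - ∑ k, x k • a k).PosSemidef}

/-- The variables `u_i, v_i` (`i = 0, …, ℓ + 1`) and `w_i, β_i` (`i = 1, …, ℓ + 1`) of the extended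
dual of a semidefinite program; `w_i` and `β_i` are stored as `w (i - 1)` and `β (i - 1)`. -/
structure SDPExtVar (n ℓ : ℕ) where
  u : Fin (ℓ + 2) → Matrix (Fin n) (Fin n) ℝ
  v : Fin (ℓ + 2) → Matrix (Fin n) (Fin n) ℝ
  w : Fin (ℓ + 1) → Matrix (Fin n) (Fin n) ℝ
  β : Fin (ℓ + 1) → ℝ

/-- The matrix `u_{ℓ+1} + v_{ℓ+1}`. -/
def SDPExtVar.lastSum {n ℓ : ℕ} (p : SDPExtVar n ℓ) : Matrix (Fin n) (Fin n) ℝ :=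
  p.u (Fin.last (ℓ + 1)) + p.v (Fin.last (ℓ + 1))

/-- The constraints of the explicit extended dual of a semidefinite program. -/
structure SDPExtFeasible {n m : ℕ} (a : Fin m → Matrix (Fin n) (Fin n) ℝ)
    (b : Matrix (Fin n) (Fin n) ℝ) (c : Fin m → ℝ) (ℓ : ℕ) (p : SDPExtVar n ℓ) : Prop where
  /-- `A* (u_{ℓ+1} + v_{ℓ+1}) = c` -/
  obj : ∀ k, matInner (a k) p.lastSum = c k
  /-- `(A, b)* (u_i + v_i) = 0` for `i = 1, …, ℓ`, the part of `A*` -/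
  null_a : ∀ i : Fin (ℓ + 2), i ≠ 0 → i ≠ Fin.last (ℓ + 1) →
    ∀ k, matInner (a k) (p.u i + p.v i) = 0
  /-- `(A, b)* (u_i + v_i) = 0` for `i = 1, …, ℓ`, the part of `b` -/
  null_b : ∀ i : Fin (ℓ + 2), i ≠ 0 → i ≠ Fin.last (ℓ + 1) → matInner b (p.u i + p.v i) = 0
  /-- `u_i ⪰ 0` for `i = 1, …, ℓ + 1` -/
  psd : ∀ i : Fin (ℓ + 1), (p.u i.succ).PosSemidef
  /-- the block matrix with rows `(u_0 + … + u_{i-1}, w_i)` and `(w_iᵀ, β_i I)` is `⪰ 0` -/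
  block : ∀ i : Fin (ℓ + 1),
    (Matrix.fromBlocks (∑ j ∈ Finset.Iio i.succ, p.u j) (p.w i) (p.w i).transpose
      (p.β i • (1 : Matrix (Fin n) (Fin n) ℝ))).PosSemidef
  /-- `v_i = w_i + w_iᵀ` for `i = 1, …, ℓ + 1` -/
  v_eq : ∀ i : Fin (ℓ + 1), p.v i.succ = p.w i + (p.w i).transpose
  u_zero : p.u 0 = 0
  v_zero : p.v 0 = 0

/-- The explicit extended dual, with the integer `ℓ`, has strong duality with the semidefinite
program. -/
def SDPExtStrongDuality {n m : ℕ} (a : Fin m → Matrix (Fin n) (Fin n) ℝ)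
    (b : Matrix (Fin n) (Fin n) ℝ) (c : Fin m → ℝ) (ℓ : ℕ) : Prop :=
  StrongDuality (sdpFeas a b) (fun x => ∑ k, c k * x k)
    {p : SDPExtVar n ℓ | SDPExtFeasible a b c ℓ p} (fun p => matInner b p.lastSum)

end SDP

end ConicDual

set_option linter.unusedSectionVars false

/-! The proof is facial reduction, made explicit. The minimal cone `F` enters only through two
properties, collected in `IsSlackFace`: every slack `b - A x` lies in `F`, and some slack is an
order unit of `F`, which for faces is the algebraic form of a relative interior point. A Slater
condition therefore holds over `F`, so the dual with cone `F*` has strong duality and attains its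
value (`IsSlackFace.exists_dual`). This rests on `exists_dual_of_isOrderUnit`, a Farkas lemma from
the M. Riesz extension theorem that needs no closedness. It remains to describe `F*`.

For `w ∈ K*` put `E = K ∩ w^⊥`. The closure of `dir(w, K*)` is `E*`, hence `tan(w, K*) = E^⊥`, and
niceness gives `E* = K* + E^⊥` (`HasFacialSplitting`). If `E` contains `F` properly, the Farkas
lemma yields `y ∈ E* ∩ L` that does not vanish on `E`. Splitting `y = u + v` and replacing `w` by `w
+ u` shrinks the face strictly and keeps it above `F` (`IsSlackFace.exists_reduction`). Each strict
step lengthens a chain of faces and also enlarges `L ∩ E^⊥`, so `ℓ` steps reach `F`. One further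
splitting then represents any element of `F*`. Conversely, in a feasible sequence all `u_i` with `i
≤ ℓ` and all `v_i` vanish on `F`, so the last sum lies in `F*` (`IsSlackFace.lastSum_mem_dualCone`).

For semidefinite programs the splitting, the tangent spaces and the bound `n` on the number of steps
come from matrix computations with kernels: `E` is generated by the `q qᵀ` with `w q = 0`, and `E^⊥`
consists of the `N + Nᵀ` for which the block matrix is positive semidefinite. -/

namespace ConicDual

/-! ### Relative interiors via prolongation of segments. -/

section RelativeInterior

variable {V : Type*} [NormedAddCommGroup V] [NormedSpace ℝ V]

theorem mem_intrinsicInterior_iff_nhdsWithin {C : Set V} {s : V} :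
    s ∈ intrinsicInterior ℝ C ↔
      s ∈ affineSpan ℝ C ∧ C ∈ nhdsWithin s (affineSpan ℝ C : Set V) := by
  rw [mem_intrinsicInterior]
  constructor
  · rintro ⟨y, hy, rfl⟩
    refine ⟨y.2, ?_⟩
    rw [mem_interior_iff_mem_nhds] at hy
    exact preimage_coe_mem_nhds_subtype.1 hy
  · rintro ⟨hs, hn⟩
    refine ⟨⟨s, hs⟩, ?_, rfl⟩
    rw [mem_interior_iff_mem_nhds]
    exact preimage_coe_mem_nhds_subtype.2 hn

/-- From a point of the relative interior one can move a little away from any point of the set. -/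
theorem exists_prolong_of_mem_intrinsicInterior {C : Set V} {s y : V}
    (hs : s ∈ intrinsicInterior ℝ C) (hy : y ∈ C) :
    ∃ ε : ℝ, 0 < ε ∧ s + ε • (s - y) ∈ C := by
  obtain ⟨hsA, hn⟩ := mem_intrinsicInterior_iff_nhdsWithin.1 hs
  have hyA : y ∈ affineSpan ℝ C := subset_affineSpan ℝ C hy
  have hmap : ∀ ε : ℝ, s + ε • (s - y) ∈ affineSpan ℝ C := by
    intro ε
    have := AffineMap.lineMap_mem (1 + ε) hyA hsA
    rw [AffineMap.lineMap_apply_module'] at this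
    convert this using 1
    module
  have hlim : Filter.Tendsto (fun ε : ℝ => s + ε • (s - y)) (nhds 0)
      (nhdsWithin s (affineSpan ℝ C : Set V)) := by
    refine tendsto_nhdsWithin_iff.2 ⟨?_, Filter.Eventually.of_forall hmap⟩
    have hc : Continuous (fun ε : ℝ => s + ε • (s - y)) := by fun_prop
    simpa using hc.tendsto 0
  have hev : ∀ᶠ ε in nhdsWithin (0 : ℝ) (Set.Ioi 0), s + ε • (s - y) ∈ C :=
    (hlim.mono_left nhdsWithin_le_nhds) hn
  obtain ⟨ε, h1, h2⟩ := (hev.and self_mem_nhdsWithin).exists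
  exact ⟨ε, h2, h1⟩

/-- A point of a convex set from which one can move a little away from any point of the set lies in
the relative interior. -/
theorem mem_intrinsicInterior_of_forall_prolong [FiniteDimensional ℝ V] {C : Set V}
    (hC : Convex ℝ C) {s : V} (hs : s ∈ C)
    (h : ∀ y ∈ C, ∃ ε : ℝ, 0 < ε ∧ s + ε • (s - y) ∈ C) : s ∈ intrinsicInterior ℝ C := by
  obtain ⟨z, hz⟩ := Set.Nonempty.intrinsicInterior hC ⟨s, hs⟩
  -- `s` now lies strictly between a relative interior point `z` and the point `z'` of `C`.
  obtain ⟨ε, hε, hz'⟩ := h z (intrinsicInterior_subset hz)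
  set z' := s + ε • (s - z) with hz'def
  obtain ⟨hzA, hn⟩ := mem_intrinsicInterior_iff_nhdsWithin.1 hz
  have hz'A : z' ∈ affineSpan ℝ C := subset_affineSpan ℝ C hz'
  rw [mem_intrinsicInterior_iff_nhdsWithin]
  refine ⟨subset_affineSpan ℝ C hs, ?_⟩
  -- The dilation centred at `z'` with ratio `(1 + ε) / ε` takes `s` to `z`. Points of the affine
  -- span near `s` go to points near `z`, hence into `C`, and convexity brings them back.
  have hlim : Filter.Tendsto (fun y : V => AffineMap.lineMap z' y ((1 + ε) / ε))
      (nhdsWithin s (affineSpan ℝ C : Set V)) (nhdsWithin z (affineSpan ℝ C : Set V)) := by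
    refine tendsto_nhdsWithin_iff.2 ⟨?_, ?_⟩
    · have hc : Continuous (fun y : V => AffineMap.lineMap z' y ((1 + ε) / ε)) := by
        simp only [AffineMap.lineMap_apply_module']
        fun_prop
      have : AffineMap.lineMap z' s ((1 + ε) / ε) = z := by
        rw [AffineMap.lineMap_apply_module', hz'def]
        match_scalars <;> field_simp <;> ring
      have h2 := hc.tendsto s
      rw [this] at h2
      exact h2.mono_left nhdsWithin_le_nhds
    · filter_upwards [self_mem_nhdsWithin] with y hy
      exact AffineMap.lineMap_mem _ hz'A hy
  filter_upwards [hlim hn] with y hy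
  have : y = (1 / (1 + ε)) • z' + (ε / (1 + ε)) • AffineMap.lineMap z' y ((1 + ε) / ε) := by
    rw [AffineMap.lineMap_apply_module']
    match_scalars <;> field_simp <;> ring
  rw [this]
  refine hC hz' hy (by positivity) (by positivity) (by field_simp)

end RelativeInterior

/-! ### Faces of a closed convex cone and their order units. -/

section Faces

variable {Y : Type*} [NormedAddCommGroup Y] [InnerProductSpace ℝ Y]

/-- `s` is an order unit of `C`: the algebraic form of "`s` is in the relative interior of the cone
`C`". -/
structure IsOrderUnit (C : Set Y) (s : Y) : Prop where
  mem : s ∈ C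
  exists_sub_mem : ∀ e ∈ C, ∃ ε : ℝ, 0 < ε ∧ s - ε • e ∈ C

variable {K : ProperCone ℝ Y}

theorem IsFace.subset {E : Set Y} (hE : IsFace (K : Set Y) E) : E ⊆ K := hE.extreme.subset

theorem IsFace.smul_mem {E : Set Y} (hE : IsFace (K : Set Y) E) {x : Y} (hx : x ∈ E) {t : ℝ}
    (ht : 0 ≤ t) : t • x ∈ E := by
  have hxK := hE.subset hx
  rcases eq_or_ne t 1 with rfl | h1
  · simpa using hx
  -- For `t < 1` the point `x` lies on the open segment from `t • x` to `2 • x`; for `t > 1`, on the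
  -- one from `t • x` to `0`.
  rcases le_or_gt t 1 with h | h
  · refine hE.extreme.left_mem_of_mem_openSegment (K.smul_mem hxK ht)
      (K.smul_mem hxK (zero_le_two (α := ℝ))) hx ?_
    have : t < 1 := lt_of_le_of_ne h h1
    refine ⟨1 / (2 - t), (1 - t) / (2 - t), by apply div_pos <;> linarith,
      by apply div_pos <;> linarith, ?_, ?_⟩
    · have : 2 - t ≠ 0 := by linarith
      field_simp
      ring
    · have : 2 - t ≠ 0 := by linarith
      match_scalars
      field_simp
      ring
  · refine hE.extreme.left_mem_of_mem_openSegment (K.smul_mem hxK ht)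
      (K.smul_mem hxK (le_refl (0 : ℝ))) hx ?_
    refine ⟨1 / t, 1 - 1 / t, by positivity, ?_, by ring, ?_⟩
    · rw [sub_pos, div_lt_one (by linarith)]
      exact h
    · match_scalars
      field_simp
      ring

theorem IsFace.add_mem {E : Set Y} (hE : IsFace (K : Set Y) E) {x y : Y} (hx : x ∈ E)
    (hy : y ∈ E) : x + y ∈ E := by
  have h := hE.smul_mem (hE.convex hx hy (by norm_num : (0 : ℝ) ≤ 1 / 2)
    (by norm_num : (0 : ℝ) ≤ 1 / 2) (by norm_num)) (zero_le_two (α := ℝ))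
  convert h using 1
  module

theorem IsFace.left_mem_of_add_mem {E : Set Y} (hE : IsFace (K : Set Y) E) {x y : Y}
    (hx : x ∈ K) (hy : y ∈ K) (hxy : x + y ∈ E) : x ∈ E := by
  have h := hE.extreme.left_mem_of_mem_openSegment (x := (2 : ℝ) • x) (y := (2 : ℝ) • y)
    (K.smul_mem hx zero_le_two) (K.smul_mem hy zero_le_two) hxy
    ⟨1 / 2, 1 / 2, by norm_num, by norm_num, by norm_num, by module⟩
  have h2 := hE.smul_mem h (by norm_num : (0 : ℝ) ≤ 1 / 2)
  convert h2 using 1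
  module

theorem IsFace.zero_mem {E : Set Y} (hE : IsFace (K : Set Y) E) : (0 : Y) ∈ E := by
  obtain ⟨x, hx⟩ := hE.nonempty
  simpa using hE.smul_mem hx (le_refl (0 : ℝ))

/-- A subset of a proper cone that is closed under addition and splitting of sums is a face. -/
theorem isFace_of_add {E : Set Y} (hEK : E ⊆ K) (h0 : (0 : Y) ∈ E)
    (hadd : ∀ x ∈ E, ∀ y ∈ E, x + y ∈ E) (hsmul : ∀ x ∈ E, ∀ t : ℝ, 0 ≤ t → t • x ∈ E)
    (hsplit : ∀ x ∈ K, ∀ y ∈ K, x + y ∈ E → x ∈ E) : IsFace (K : Set Y) E := by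
  refine ⟨fun x hx y hy a b ha hb _ => hadd _ (hsmul x hx a ha) _ (hsmul y hy b hb), ⟨0, h0⟩,
    ⟨hEK, ?_⟩⟩
  rintro x hx y hy z hz ⟨a, b, ha, hb, -, rfl⟩
  have h := hsplit (a • x) (K.smul_mem hx ha.le) (b • y) (K.smul_mem hy hb.le) hz
  have h2 := hsmul _ h a⁻¹ (by positivity)
  rwa [smul_smul, inv_mul_cancel₀ ha.ne', one_smul] at h2

/-- A face of a proper cone, as a pointed cone. -/
def IsFace.toPointedCone {E : Set Y} (hE : IsFace (K : Set Y) E) : PointedCone ℝ Y :=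
  PointedCone.ofConeComb E hE.nonempty fun _ hx _ hy _ ha _ hb =>
    hE.add_mem (hE.smul_mem hx ha) (hE.smul_mem hy hb)

theorem IsFace.exists_sub_of_mem_span {E : Set Y} (hE : IsFace (K : Set Y) E) {x : Y}
    (hx : x ∈ Submodule.span ℝ E) : ∃ e ∈ E, ∃ f ∈ E, x = e - f := by
  induction hx using Submodule.span_induction with
  | mem x hx => exact ⟨x, hx, 0, hE.zero_mem, by simp⟩
  | zero => exact ⟨0, hE.zero_mem, 0, hE.zero_mem, by simp⟩
  | add x y _ _ hx hy =>
    obtain ⟨e, he, f, hf, rfl⟩ := hx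
    obtain ⟨e', he', f', hf', rfl⟩ := hy
    exact ⟨e + e', hE.add_mem he he', f + f', hE.add_mem hf hf', by abel⟩
  | smul a x _ hx =>
    obtain ⟨e, he, f, hf, rfl⟩ := hx
    rcases le_total 0 a with ha | ha
    · exact ⟨a • e, hE.smul_mem he ha, a • f, hE.smul_mem hf ha, by module⟩
    · exact ⟨(-a) • f, hE.smul_mem hf (by linarith), (-a) • e, hE.smul_mem he (by linarith),
        by module⟩

/-- Writing `x = e - f` with `e, f ∈ E` gives `x + f = e ∈ E`, and a face splits sums. So a face is
determined by its span, which serves both the dimension bound on chains and the bipolar argument for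
nice cones. -/
theorem IsFace.mem_of_mem_span {E : Set Y} (hE : IsFace (K : Set Y) E) {x : Y} (hxK : x ∈ K)
    (hx : x ∈ Submodule.span ℝ E) : x ∈ E := by
  obtain ⟨e, he, f, hf, rfl⟩ := hE.exists_sub_of_mem_span hx
  exact hE.left_mem_of_add_mem hxK (hE.subset hf) (by simpa using he)

/-- The two forms differ by rescaling: `s + ε (s - e)` is `1 + ε` times `s - (ε / (1 + ε)) e`, and
conversely `s - ε e` becomes a prolongation after adding `ε s`. -/
theorem IsFace.isOrderUnit_iff [FiniteDimensional ℝ Y] {E : Set Y} (hE : IsFace (K : Set Y) E)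
    {s : Y} : s ∈ intrinsicInterior ℝ E ↔ IsOrderUnit E s := by
  constructor
  · refine fun hs => ⟨intrinsicInterior_subset hs, fun e he => ?_⟩
    obtain ⟨ε, hε, h⟩ := exists_prolong_of_mem_intrinsicInterior hs he
    refine ⟨ε / (1 + ε), by positivity, ?_⟩
    have := hE.smul_mem h (by positivity : (0 : ℝ) ≤ 1 / (1 + ε))
    convert this using 1
    match_scalars <;> field_simp
  · refine fun hs => mem_intrinsicInterior_of_forall_prolong hE.convex hs.mem fun e he => ?_
    obtain ⟨ε, hε, h⟩ := hs.exists_sub_mem e he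
    refine ⟨ε, hε, ?_⟩
    have := hE.add_mem h (hE.smul_mem hs.mem hε.le)
    convert this using 1
    module

theorem IsFace.exists_isOrderUnit [FiniteDimensional ℝ Y] {E : Set Y}
    (hE : IsFace (K : Set Y) E) : ∃ s, IsOrderUnit E s := by
  obtain ⟨s, hs⟩ := Set.Nonempty.intrinsicInterior hE.convex hE.nonempty
  exact ⟨s, hE.isOrderUnit_iff.1 hs⟩

/-- A face that contains an order unit of a subset of the cone contains this subset. -/
theorem IsFace.subset_of_isOrderUnit {E F : Set Y} (hE : E ⊆ K) (hF : IsFace (K : Set Y) F)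
    {s : Y} (hs : IsOrderUnit E s) (hsF : s ∈ F) : E ⊆ F := by
  intro e he
  obtain ⟨ε, hε, h⟩ := hs.exists_sub_mem e he
  have h1 : ε • e ∈ F := hF.left_mem_of_add_mem (K.smul_mem (hE he) hε.le) (hE h)
    (by simpa using hsF)
  have h2 := hF.smul_mem h1 (inv_nonneg.2 hε.le)
  rwa [smul_smul, inv_mul_cancel₀ hε.ne', one_smul] at h2

/-- The smallest face of `K` that contains `s`. -/
def minFace (K : ProperCone ℝ Y) (s : Y) : Set Y :=
  {y | y ∈ K ∧ ∃ ε : ℝ, 0 < ε ∧ s - ε • y ∈ K}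

theorem isFace_minFace {s : Y} (hs : s ∈ K) : IsFace (K : Set Y) (minFace K s) := by
  refine isFace_of_add (fun y hy => hy.1) ⟨K.zero_mem, 1, one_pos, by simpa using hs⟩ ?_ ?_ ?_
  · rintro x ⟨hx, ε, hε, hxε⟩ y ⟨hy, δ, hδ, hyδ⟩
    -- The convex combination of `s - ε x` and `s - δ y` in which `x` and `y` get equal
    -- coefficients.
    refine ⟨K.add_mem hx hy, ε * δ / (ε + δ), by positivity, ?_⟩
    have := K.add_mem (K.smul_mem hxε (by positivity : 0 ≤ δ / (ε + δ)))
      (K.smul_mem hyδ (by positivity : 0 ≤ ε / (ε + δ)))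
    suffices h : s - (ε * δ / (ε + δ)) • (x + y) =
        (δ / (ε + δ)) • (s - ε • x) + (ε / (ε + δ)) • (s - δ • y) by
      rw [h]
      exact this
    match_scalars <;> field_simp
    ring
  · rintro x ⟨hx, ε, hε, hxε⟩ t ht
    refine ⟨K.smul_mem hx ht, ε / (1 + t), by positivity, ?_⟩
    have := K.add_mem hxε (K.smul_mem hx (by positivity : 0 ≤ ε / (1 + t)))
    suffices h : s - (ε / (1 + t)) • t • x = s - ε • x + (ε / (1 + t)) • x by
      rw [h]
      exact this
    match_scalars
    · field_simp
    · field_simp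
      ring
  · rintro x hx y hy ⟨-, ε, hε, h⟩
    refine ⟨hx, ε, hε, ?_⟩
    have := K.add_mem h (K.smul_mem hy hε.le)
    suffices h : s - ε • x = s - ε • (x + y) + ε • y by
      rw [h]
      exact this
    module

theorem isOrderUnit_minFace {s : Y} (hs : s ∈ K) : IsOrderUnit (minFace K s) s := by
  refine ⟨⟨hs, 1, one_pos, by simp⟩, ?_⟩
  rintro e ⟨he, ε, hε, h⟩
  refine ⟨ε, hε, h, 1, one_pos, ?_⟩
  convert K.smul_mem he hε.le using 1
  module

/-- The face of `K` exposed by `w`. -/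
def exposedFace (K : ProperCone ℝ Y) (w : Y) : Set Y := {x | x ∈ K ∧ ⟪w, x⟫_ℝ = 0}

end Faces

/-! ### Exposed faces, tangent spaces of the dual cone, and splitting. -/

section DualCone

variable {Y : Type*} [NormedAddCommGroup Y] [InnerProductSpace ℝ Y] [FiniteDimensional ℝ Y]
  {K : ProperCone ℝ Y}

theorem mem_dualCone {S : Set Y} {y : Y} : y ∈ dualCone S ↔ ∀ x ∈ S, 0 ≤ ⟪y, x⟫_ℝ := by
  unfold dualCone
  simp only [SetLike.mem_coe, ProperCone.mem_innerDual, real_inner_comm]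

theorem zero_mem_dualCone (S : Set Y) : (0 : Y) ∈ dualCone S := by simp [mem_dualCone]

theorem add_mem_dualCone {S : Set Y} {x y : Y} (hx : x ∈ dualCone S) (hy : y ∈ dualCone S) :
    x + y ∈ dualCone S := by
  rw [mem_dualCone] at *
  intro z hz
  rw [inner_add_left]
  exact add_nonneg (hx z hz) (hy z hz)

theorem smul_mem_dualCone {S : Set Y} {x : Y} (hx : x ∈ dualCone S) {t : ℝ} (ht : 0 ≤ t) :
    t • x ∈ dualCone S := by
  rw [mem_dualCone] at *
  intro z hz
  rw [real_inner_smul_left]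
  exact mul_nonneg ht (hx z hz)

theorem isFace_exposedFace {w : Y} (hw : w ∈ dualCone (K : Set Y)) :
    IsFace (K : Set Y) (exposedFace K w) := by
  rw [mem_dualCone] at hw
  refine isFace_of_add (fun y hy => hy.1) ⟨K.zero_mem, by simp⟩ ?_ ?_ ?_
  · rintro x ⟨hx, hx0⟩ y ⟨hy, hy0⟩
    exact ⟨K.add_mem hx hy, by rw [inner_add_right, hx0, hy0, add_zero]⟩
  · rintro x ⟨hx, hx0⟩ t ht
    exact ⟨K.smul_mem hx ht, by rw [real_inner_smul_right, hx0, mul_zero]⟩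
  · rintro x hx y hy ⟨-, h⟩
    rw [inner_add_right] at h
    exact ⟨hx, by linarith [hw x hx, hw y hy]⟩

/-- A vector that is nonnegative on the dual of a pointed cone lies in its closure. -/
theorem mem_closure_of_forall_inner_nonneg (C : PointedCone ℝ Y) {y : Y}
    (h : ∀ z, (∀ c ∈ C, 0 ≤ ⟪c, z⟫_ℝ) → 0 ≤ ⟪y, z⟫_ℝ) : y ∈ closure (C : Set Y) := by
  by_contra hy
  have hy' : y ∉ (Submodule.closure C : ProperCone ℝ Y) := hy
  obtain ⟨z, hz, hyz⟩ := ProperCone.hyperplane_separation' _ hy'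
  exact absurd (h z fun c hc => hz c (subset_closure hc)) (not_le.2 hyz)

theorem mem_of_forall_dualCone {x : Y} (h : ∀ z ∈ dualCone (K : Set Y), 0 ≤ ⟪z, x⟫_ℝ) :
    x ∈ K := by
  have : x ∈ closure (K.toPointedCone : Set Y) :=
    mem_closure_of_forall_inner_nonneg _ fun z hz => by
      rw [real_inner_comm]
      exact h z (mem_dualCone.2 fun c hc => by rw [real_inner_comm]; exact hz c hc)
  rwa [show (K.toPointedCone : Set Y) = K from rfl, K.isClosed.closure_eq] at this

/-- The closure of the feasible directions of the dual cone is the dual of the exposed face. -/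
theorem closure_feasDir_dualCone {w : Y} (hw : w ∈ dualCone (K : Set Y)) :
    closure (feasDir w (dualCone (K : Set Y))) = dualCone (exposedFace K w) := by
  apply subset_antisymm
  · refine closure_minimal ?_ (ProperCone.isClosed _)
    rintro y ⟨t, ht, hy⟩
    rw [mem_dualCone] at hy ⊢
    rintro x ⟨hx, hx0⟩
    have := hy x hx
    rw [inner_add_left, hx0, zero_add, real_inner_smul_left] at this
    exact nonneg_of_mul_nonneg_right this ht
  · intro y hy
    rw [mem_dualCone] at hy
    -- The cone `K* + ℝ w` consists of feasible directions, and its dual is `K ∩ w^⊥`; by the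
    -- bipolar theorem its closure contains the dual of that face.
    have hsub : (((ProperCone.innerDual (K : Set Y)).toPointedCone ⊔
        PointedCone.ofSubmodule (Submodule.span ℝ {w}) : PointedCone ℝ Y) : Set Y) ⊆
        feasDir w (dualCone (K : Set Y)) := by
      intro z hz
      obtain ⟨k, hk, l, hl, rfl⟩ := Submodule.mem_sup.1 hz
      obtain ⟨r, rfl⟩ := Submodule.mem_span_singleton.1 hl
      -- A step this short keeps the total coefficient `1 + r / (1 + |r|)` of `w` nonnegative.
      refine ⟨1 / (1 + |r|), by positivity, ?_⟩
      have hr : 0 ≤ 1 + r / (1 + |r|) := by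
        have : 0 < 1 + |r| := by positivity
        have h2 : 1 + r / (1 + |r|) = (1 + |r| + r) / (1 + |r|) := by field_simp
        rw [h2]
        apply div_nonneg _ this.le
        linarith [neg_abs_le r]
      have h := add_mem_dualCone (smul_mem_dualCone hw hr)
        (smul_mem_dualCone (show k ∈ dualCone (K : Set Y) from hk)
          (by positivity : 0 ≤ 1 / (1 + |r|)))
      convert h using 1
      match_scalars <;> field_simp
    refine closure_mono hsub (mem_closure_of_forall_inner_nonneg _ fun z hz => hy z ⟨?_, ?_⟩)
    · refine mem_of_forall_dualCone fun k hk => hz k ?_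
      exact Submodule.mem_sup_left hk
    · have hmem : ∀ r : ℝ, r • w ∈ ((ProperCone.innerDual (K : Set Y)).toPointedCone ⊔
          PointedCone.ofSubmodule (Submodule.span ℝ {w}) : PointedCone ℝ Y) := fun r =>
        Submodule.mem_sup_right (Submodule.smul_mem _ r (Submodule.mem_span_singleton_self w))
      have h1 := hz _ (hmem 1)
      have h2 := hz _ (hmem (-1))
      rw [real_inner_smul_left] at h1 h2
      linarith

/-- The lineality space of the dual of `K ∩ w^⊥` is the orthogonal complement of that face. All
later arguments use this form of the tangent space. -/
theorem mem_tangentSpace_dualCone {w y : Y} (hw : w ∈ dualCone (K : Set Y)) :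
    y ∈ tangentSpace w (dualCone (K : Set Y)) ↔ ∀ x ∈ exposedFace K w, ⟪y, x⟫_ℝ = 0 := by
  unfold tangentSpace
  rw [closure_feasDir_dualCone hw, Set.mem_inter_iff, Set.mem_neg, mem_dualCone, mem_dualCone]
  constructor
  · rintro ⟨h1, h2⟩ x hx
    have := h2 x hx
    rw [inner_neg_left] at this
    linarith [h1 x hx]
  · intro h
    exact ⟨fun x hx => (h x hx).ge, fun x hx => by rw [inner_neg_left, h x hx, neg_zero]⟩

/-- `(K ∩ w^⊥)* = K* + (K ∩ w^⊥)^⊥` for all `w` in the dual cone. -/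
def HasFacialSplitting (K : ProperCone ℝ Y) : Prop :=
  ∀ w ∈ dualCone (K : Set Y), ∀ y ∈ dualCone (exposedFace K w),
    ∃ u ∈ dualCone (K : Set Y), ∃ v, (∀ x ∈ exposedFace K w, ⟪v, x⟫_ℝ = 0) ∧ y = u + v

/-- The dual of `K* + E^⊥` is `K ∩ span E`, which equals `E` because a face is cut out by its span.
Hence `E*` is the closure of `K* + E^⊥`, and niceness removes the closure. -/
theorem IsNice.hasFacialSplitting (hK : IsNice K) : HasFacialSplitting K := by
  intro w hw y hy
  have hE := isFace_exposedFace hw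
  set E := exposedFace K w
  rw [mem_dualCone] at hy
  set C : PointedCone ℝ Y := (ProperCone.innerDual (K : Set Y)).toPointedCone ⊔
    PointedCone.ofSubmodule (Submodule.span ℝ E)ᗮ
  have hC : (C : Set Y) = dualCone (K : Set Y) + ((Submodule.span ℝ E)ᗮ : Set Y) :=
    Submodule.coe_sup _ _
  have hmem : y ∈ closure (C : Set Y) := by
    refine mem_closure_of_forall_inner_nonneg _ fun z hz => hy z (hE.mem_of_mem_span ?_ ?_)
    · exact mem_of_forall_dualCone fun k hk => hz k (Submodule.mem_sup_left hk)
    · rw [← Submodule.orthogonal_orthogonal (Submodule.span ℝ E), Submodule.mem_orthogonal]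
      intro v hv
      have h1 := hz v (Submodule.mem_sup_right hv)
      have h2 := hz (-v) (Submodule.mem_sup_right (Submodule.neg_mem _ hv))
      rw [inner_neg_left] at h2
      linarith
  rw [hC, (hK E hE).closure_eq] at hmem
  obtain ⟨u, hu, v, hv, rfl⟩ := Set.mem_add.1 hmem
  refine ⟨u, hu, v, fun x hx => ?_, rfl⟩
  rw [real_inner_comm]
  exact (Submodule.mem_orthogonal _ _).1 hv x (Submodule.subset_span hx)

end DualCone

/-! ### A Farkas lemma from the Riesz extension theorem. -/

section Extension

variable {Y : Type*} [NormedAddCommGroup Y] [InnerProductSpace ℝ Y] [FiniteDimensional ℝ Y]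

/-- Some multiple of an order unit dominates both `v` and `-v`, for `v` in the span of the cone. -/
theorem IsOrderUnit.exists_dominates {C : PointedCone ℝ Y} {s : Y}
    (hs : IsOrderUnit (C : Set Y) s) {v : Y} (hv : v ∈ Submodule.span ℝ (C : Set Y)) :
    ∃ N : ℝ, 0 ≤ N ∧ N • s + v ∈ C ∧ N • s - v ∈ C := by
  induction hv using Submodule.span_induction with
  | mem e he =>
    obtain ⟨ε, hε, h⟩ := hs.exists_sub_mem e he
    refine ⟨1 / ε, by positivity, C.add_mem (C.smul_mem (by positivity) hs.mem) he, ?_⟩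
    have := PointedCone.smul_mem C (by positivity : 0 ≤ 1 / ε) h
    convert this using 1
    match_scalars <;> field_simp
  | zero => exact ⟨0, le_rfl, by simp, by simp⟩
  | add x y _ _ hx hy =>
    obtain ⟨N, hN, h1, h2⟩ := hx
    obtain ⟨M, hM, h3, h4⟩ := hy
    refine ⟨N + M, by positivity, ?_, ?_⟩
    · convert C.add_mem h1 h3 using 1
      module
    · convert C.add_mem h2 h4 using 1
      module
  | smul a x _ hx =>
    obtain ⟨N, hN, h1, h2⟩ := hx
    rcases le_total 0 a with ha | ha
    · refine ⟨a * N, by positivity, ?_, ?_⟩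
      · convert PointedCone.smul_mem C ha h1 using 1
        module
      · convert PointedCone.smul_mem C ha h2 using 1
        module
    · have ha' : 0 ≤ -a := by linarith
      refine ⟨-a * N, by positivity, ?_, ?_⟩
      · convert PointedCone.smul_mem C ha' h2 using 1
        module
      · convert PointedCone.smul_mem C ha' h1 using 1
        module

/-- A Farkas lemma without closedness: if the range of `T` contains an order unit of the cone `C`,
then every functional that is nonnegative on `T ⁻¹ C` is the pull-back of a vector in the dual
cone. -/
theorem exists_dual_of_isOrderUnit {P : Type*} [AddCommGroup P] [Module ℝ P]
    (C : PointedCone ℝ Y) (T : P →ₗ[ℝ] Y) (f : P →ₗ[ℝ] ℝ) (hf : ∀ p, T p ∈ C → 0 ≤ f p) (p₀ : P)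
    (hp₀ : IsOrderUnit (C : Set Y) (T p₀)) :
    ∃ y ∈ dualCone (C : Set Y), ∀ p, ⟪y, T p⟫_ℝ = f p := by
  set Z : Submodule ℝ Y := Submodule.span ℝ (C : Set Y) ⊔ LinearMap.range T
  have hTZ : ∀ p, T p ∈ Z := fun p => Submodule.mem_sup_right ⟨p, rfl⟩
  have hCZ : ∀ e ∈ C, e ∈ Z := fun e he => Submodule.mem_sup_left (Submodule.subset_span he)
  let Φ : (P × Z) →ₗ[ℝ] Y := Z.subtype ∘ₗ LinearMap.snd ℝ P Z + T ∘ₗ LinearMap.fst ℝ P Z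
  have hΦ : ∀ p z, Φ (p, z) = (z : Y) + T p := fun p z => rfl
  -- Extending from `P × 0` to `P × Z`, instead of from the range of `T`, avoids checking that `f`
  -- factors through `T`; this follows at the end.
  let D : (P × Z) →ₗ.[ℝ] ℝ :=
    ⟨LinearMap.ker (LinearMap.snd ℝ P Z), f ∘ₗ LinearMap.fst ℝ P Z ∘ₗ Submodule.subtype _⟩
  obtain ⟨g, hgD, hgC⟩ := riesz_extension (C.comap Φ) D (by
    rintro ⟨⟨p, z⟩, hz⟩ hmem
    have hz' : z = 0 := hz
    subst hz'
    refine hf p ?_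
    have : Φ (p, 0) ∈ C := hmem
    rw [hΦ] at this
    simpa using this) (by
    rintro ⟨p, z, hz⟩
    obtain ⟨v, hv, w, ⟨q, rfl⟩, rfl⟩ := Submodule.mem_sup.1 hz
    obtain ⟨N, hN, h1, -⟩ := hp₀.exists_dominates hv
    -- Chosen so that the sum maps to `v + N • T p₀`, which lies in `C` because `T p₀` is an order
    -- unit.
    refine ⟨⟨(-p - q + N • p₀, 0), rfl⟩, ?_⟩
    change Φ ((-p - q + N • p₀, 0) + (p, ⟨v + T q, hz⟩)) ∈ C
    rw [Prod.mk_add_mk, hΦ]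
    convert h1 using 1
    simp only [map_add, map_sub, map_neg, map_smul, zero_add]
    abel)
  let h : Z →ₗ[ℝ] ℝ := g ∘ₗ LinearMap.inr ℝ P Z
  let z₀ : Z := (InnerProductSpace.toDual ℝ Z).symm (LinearMap.toContinuousLinearMap h)
  have hz₀ : ∀ z : Z, ⟪(z₀ : Y), z⟫_ℝ = g (0, z) := by
    intro z
    rw [← Submodule.coe_inner, InnerProductSpace.toDual_symm_apply]
    rfl
  refine ⟨z₀, ?_, ?_⟩
  · rw [mem_dualCone]
    intro e he
    have := hz₀ ⟨e, hCZ e he⟩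
    rw [this]
    refine hgC _ ?_
    change Φ _ ∈ C
    rw [hΦ]
    simpa using he
  · intro p
    have := hz₀ ⟨T p, hTZ p⟩
    rw [this]
    -- `Φ` sends `(q, -T q)` to `0 ∈ C`. Applying the inequality to `p` and to `-p` forces equality.
    have h1 : ∀ q, 0 ≤ f q - g (0, ⟨T q, hTZ q⟩) := by
      intro q
      have h2 : 0 ≤ g (q, -⟨T q, hTZ q⟩) := by
        refine hgC _ ?_
        change Φ _ ∈ C
        rw [hΦ]
        simp
      have h3 : (q, -⟨T q, hTZ q⟩) = ((q, 0) : P × Z) - (0, ⟨T q, hTZ q⟩) := by simp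
      have h4 : g (q, 0) = f q := hgD ⟨(q, 0), rfl⟩
      rwa [h3, map_sub, h4] at h2
    have h5 := h1 p
    have h6 := h1 (-p)
    have h7 : ((0, ⟨T (-p), hTZ (-p)⟩) : P × Z) = -(0, ⟨T p, hTZ p⟩) := by
      ext <;> simp
    rw [h7, map_neg, map_neg] at h6
    linarith

end Extension

/-! ### Minimal cone, strong duality over it, one reduction step, and soundness. -/

section Conic

variable {X Y : Type*} [NormedAddCommGroup X] [InnerProductSpace ℝ X] [FiniteDimensional ℝ X]
  [NormedAddCommGroup Y] [InnerProductSpace ℝ Y] [FiniteDimensional ℝ Y]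
  {A : X →ₗ[ℝ] Y} {b : Y} {K : ProperCone ℝ Y} {F : Set Y}

theorem convex_primalFeas : Convex ℝ (primalFeas A b K) := by
  intro x hx y hy α β hα hβ hαβ
  have h := K.convex (x := b - A x) hx (y := b - A y) hy hα hβ hαβ
  suffices h2 : b - A (α • x + β • y) = α • (b - A x) + β • (b - A y) by
    change b - A (α • x + β • y) ∈ K
    rw [h2]
    exact h
  have hb : b = (α + β) • b := by rw [hαβ, one_smul]
  rw [map_add, map_smul, map_smul]
  nth_rewrite 1 [hb]
  module

theorem mem_nullL {y : Y} : y ∈ nullL A b ↔ (∀ x, ⟪y, A x⟫_ℝ = 0) ∧ ⟪y, b⟫_ℝ = 0 := by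
  unfold nullL
  rw [Submodule.mem_inf, LinearMap.mem_ker, LinearMap.mem_ker, innerₗ_apply_apply,
    real_inner_comm]
  refine and_congr_left fun _ => ⟨fun h x => ?_, fun h => ?_⟩
  · rw [← LinearMap.adjoint_inner_left, h, inner_zero_left]
  · refine ext_inner_right ℝ fun x => ?_
    rw [LinearMap.adjoint_inner_left, h, inner_zero_left]

theorem inner_slack_of_mem_nullL {y : Y} (hy : y ∈ nullL A b) (x : X) : ⟪y, b - A x⟫_ℝ = 0 := by
  rw [mem_nullL] at hy
  rw [inner_sub_right, hy.1, hy.2, sub_zero]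

/-- What the minimal cone is used for: a face of `K` that contains all slacks, and some slack in its
relative interior. -/
structure IsSlackFace (A : X →ₗ[ℝ] Y) (b : Y) (K : ProperCone ℝ Y) (F : Set Y) : Prop where
  isFace : IsFace (K : Set Y) F
  slack_mem : ∀ x ∈ primalFeas A b K, b - A x ∈ F
  exists_isOrderUnit : ∃ x, IsOrderUnit F (b - A x)

/-- The segment from `x'` through `x` can be prolonged within the feasible set, so the slack of `x`
lies on an open segment of `K` with the slack of `x'` as an endpoint. -/
theorem slack_mem_of_mem_intrinsicInterior {x x' : X}
    (hx : x ∈ intrinsicInterior ℝ (primalFeas A b K)) (hF : IsFace (K : Set Y) F)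
    (hxF : b - A x ∈ F) (hx' : x' ∈ primalFeas A b K) : b - A x' ∈ F := by
  obtain ⟨ε, hε, h⟩ := exists_prolong_of_mem_intrinsicInterior hx hx'
  refine hF.extreme.left_mem_of_mem_openSegment hx' h hxF ?_
  refine ⟨ε / (1 + ε), 1 / (1 + ε), by positivity, by positivity, by field_simp; ring, ?_⟩
  simp only [map_add, map_smul, map_sub]
  match_scalars <;> field_simp <;> ring

theorem IsMinimalCone.isSlackFace (h : IsMinimalCone A b K F) : IsSlackFace A b K F := by
  obtain ⟨hF, x, hx, hxF⟩ := h
  exact ⟨hF, fun x' hx' =>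
    slack_mem_of_mem_intrinsicInterior hx hF (intrinsicInterior_subset hxF) hx',
    x, hF.isOrderUnit_iff.1 hxF⟩

theorem IsSlackFace.subset {F' : Set Y} (h : IsSlackFace A b K F) (h' : IsSlackFace A b K F') :
    F ⊆ F' := by
  obtain ⟨x, hx⟩ := h.exists_isOrderUnit
  exact h'.isFace.subset_of_isOrderUnit h.isFace.subset hx
    (h'.slack_mem x (h.isFace.subset hx.mem))

/-- Existence takes the smallest face through the slack of a relative interior point. Uniqueness
holds since of two slack faces each contains an order unit of the other. -/
theorem existsUnique_isMinimalCone (hfeas : (primalFeas A b K).Nonempty) :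
    ∃! F : Set Y, IsMinimalCone A b K F := by
  obtain ⟨x, hx⟩ := Set.Nonempty.intrinsicInterior (convex_primalFeas (A := A) (b := b)) hfeas
  have hxK : x ∈ primalFeas A b K := intrinsicInterior_subset hx
  refine ⟨minFace K (b - A x), ⟨isFace_minFace hxK, x, hx,
    (isFace_minFace hxK).isOrderUnit_iff.2 (isOrderUnit_minFace hxK)⟩, fun F' hF' => ?_⟩
  have h0 : IsMinimalCone A b K (minFace K (b - A x)) := ⟨isFace_minFace hxK, x, hx,
    (isFace_minFace hxK).isOrderUnit_iff.2 (isOrderUnit_minFace hxK)⟩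
  exact subset_antisymm (hF'.isSlackFace.subset h0.isSlackFace)
    (h0.isSlackFace.subset hF'.isSlackFace)

/-- The affine family of slacks, homogenized. -/
def slackMap (A : X →ₗ[ℝ] Y) (b : Y) : (ℝ × X) →ₗ[ℝ] Y :=
  (LinearMap.fst ℝ ℝ X).smulRight b - A ∘ₗ LinearMap.snd ℝ ℝ X

theorem slackMap_apply (t : ℝ) (x : X) : slackMap A b (t, x) = t • b - A x := rfl

/-- A homogenized slack in the cone, plus a multiple of a slack, is a multiple of a slack. -/
theorem slackMap_add_smul {t N : ℝ} {x x₀ : X} (hpos : 0 < t + N) :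
    slackMap A b (t, x) + N • (b - A x₀) =
      (t + N) • (b - A ((t + N)⁻¹ • (x + N • x₀))) := by
  rw [slackMap_apply, smul_sub (t + N), ← map_smul, smul_smul, mul_inv_cancel₀ hpos.ne', one_smul,
    map_add, map_smul]
  module

/-- Strong duality between the primal and the dual over a face that contains a slack in its relative
interior. -/
theorem IsSlackFace.exists_dual (hF : IsSlackFace A b K F) {c : X} {val : ℝ}
    (hval : IsLUB ((fun x => ⟪c, x⟫_ℝ) '' primalFeas A b K) val) :
    ∃ y ∈ dualCone F, LinearMap.adjoint A y = c ∧ ⟪b, y⟫_ℝ = val := by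
  obtain ⟨x₀, hx₀⟩ := hF.exists_isOrderUnit
  let f : (ℝ × X) →ₗ[ℝ] ℝ := val • LinearMap.fst ℝ ℝ X - innerₗ X c ∘ₗ LinearMap.snd ℝ ℝ X
  have hf : ∀ t x, f (t, x) = val * t - ⟪c, x⟫_ℝ := fun t x => rfl
  obtain ⟨y, hy, hyf⟩ := exists_dual_of_isOrderUnit hF.isFace.toPointedCone (slackMap A b) f (by
    rintro ⟨t, x⟩ hmem
    rw [hf]
    have hmem' : slackMap A b (t, x) ∈ K := hF.isFace.subset hmem
    -- The homogenizing variable `t` may be nonpositive. Adding `N` times the slack of a feasible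
    -- `x'` makes the total `t + N` positive, so rescaling gives a feasible point; taking the
    -- supremum over `x'` then cancels `N * val`.
    set N := |t| + 1
    have hN : 0 < N := by positivity
    have hpos : 0 < t + N := by linarith [neg_abs_le t]
    have key : ∀ x' ∈ primalFeas A b K, ⟪c, x'⟫_ℝ ≤ ((t + N) * val - ⟪c, x⟫_ℝ) / N := by
      intro x' hx'
      have h1 := K.add_mem hmem' (K.smul_mem hx' hN.le)
      rw [slackMap_add_smul hpos] at h1
      have h2 := K.smul_mem h1 (inv_nonneg.2 hpos.le)
      rw [smul_smul, inv_mul_cancel₀ hpos.ne', one_smul] at h2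
      have h3 := hval.1 (Set.mem_image_of_mem (fun x => ⟪c, x⟫_ℝ)
        (show _ ∈ primalFeas A b K from h2))
      simp only [inner_add_right, real_inner_smul_right] at h3
      rw [inv_mul_le_iff₀ hpos] at h3
      rw [le_div_iff₀ hN]
      linarith
    have hle : val ≤ ((t + N) * val - ⟪c, x⟫_ℝ) / N := by
      refine hval.2 ?_
      rintro _ ⟨x', hx', rfl⟩
      exact key x' hx'
    rw [le_div_iff₀ hN] at hle
    linarith) (1, x₀) (by
    rw [slackMap_apply, one_smul]
    exact hx₀)
  refine ⟨y, hy, ?_, ?_⟩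
  · refine ext_inner_right ℝ fun x => ?_
    have := hyf (0, -x)
    rw [hf, slackMap_apply, zero_smul, map_neg, inner_neg_right] at this
    rw [LinearMap.adjoint_inner_left]
    simpa using this
  · have := hyf (1, 0)
    rw [hf, slackMap_apply, one_smul, map_zero, sub_zero] at this
    rw [real_inner_comm]
    simpa using this

theorem IsSlackFace.weak_duality (hF : IsSlackFace A b K F) {x : X} (hx : x ∈ primalFeas A b K)
    {y : Y} (hy : y ∈ dualCone F) : ⟪LinearMap.adjoint A y, x⟫_ℝ ≤ ⟪b, y⟫_ℝ := by
  have := mem_dualCone.1 hy _ (hF.slack_mem x hx)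
  rw [inner_sub_right, real_inner_comm] at this
  rw [LinearMap.adjoint_inner_left]
  linarith

/-- Any representation of the dual of the minimal cone yields a dual with strong duality. -/
theorem IsSlackFace.strongDuality (hF : IsSlackFace A b K F)
    (hfeas : (primalFeas A b K).Nonempty) (c : X) {β : Type*} {D : Set β} {φ : β → Y}
    (hD : dualCone F = φ '' D) :
    StrongDuality (primalFeas A b K) (fun x => ⟪c, x⟫_ℝ)
      {p | LinearMap.adjoint A (φ p) = c ∧ p ∈ D} (fun p => ⟪b, φ p⟫_ℝ) := by
  have hweak : ∀ p ∈ {p | LinearMap.adjoint A (φ p) = c ∧ p ∈ D},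
      ⟪b, φ p⟫_ℝ ∈ upperBounds ((fun x => ⟪c, x⟫_ℝ) '' primalFeas A b K) := by
    rintro p ⟨hpc, hpD⟩ _ ⟨x, hx, rfl⟩
    have := hF.weak_duality hx (hD ▸ Set.mem_image_of_mem φ hpD : φ p ∈ dualCone F)
    rwa [hpc] at this
  have hstrong : ∀ val, IsLUB ((fun x => ⟪c, x⟫_ℝ) '' primalFeas A b K) val →
      ∃ p ∈ {p | LinearMap.adjoint A (φ p) = c ∧ p ∈ D}, ⟪b, φ p⟫_ℝ = val := by
    intro val hval
    obtain ⟨y, hy, hyc, hyb⟩ := hF.exists_dual hval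
    rw [hD] at hy
    obtain ⟨p, hp, rfl⟩ := hy
    exact ⟨p, ⟨hyc, hp⟩, hyb⟩
  refine ⟨⟨fun hbdd => ?_, fun ⟨p, hp⟩ => ⟨_, hweak p hp⟩⟩, fun ⟨p, hp⟩ => ?_⟩
  · obtain ⟨p, hp, -⟩ := hstrong _ (isLUB_csSup (hfeas.image _) hbdd)
    exact ⟨p, hp⟩
  · have hlub := isLUB_csSup (hfeas.image (fun x => ⟪c, x⟫_ℝ)) ⟨_, hweak p hp⟩
    refine ⟨_, hlub, ?_, ?_⟩
    · obtain ⟨q, hq, hqv⟩ := hstrong _ hlub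
      exact ⟨q, hq, hqv⟩
    · rintro _ ⟨q, hq, rfl⟩
      exact hlub.2 (hweak q hq)

/-- One step of facial reduction. -/
theorem IsSlackFace.exists_reduction (hF : IsSlackFace A b K F) (hK : HasFacialSplitting K)
    {w : Y} (hw : w ∈ dualCone (K : Set Y)) (hFw : F ⊆ exposedFace K w)
    (hne : exposedFace K w ≠ F) :
    ∃ u ∈ dualCone (K : Set Y), ∃ v, (∀ x ∈ exposedFace K w, ⟪v, x⟫_ℝ = 0) ∧ u + v ∈ nullL A b ∧
      ∃ x ∈ exposedFace K w, ⟪u, x⟫_ℝ ≠ 0 := by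
  have hE := isFace_exposedFace hw
  set E := exposedFace K w
  obtain ⟨s, hs⟩ := hE.exists_isOrderUnit
  obtain ⟨x₀, hx₀⟩ := hF.exists_isOrderUnit
  -- The functional `(q, r) ↦ r` is nonnegative on `T ⁻¹ E`: if `r < 0`, some homogenized slack is
  -- an order unit of `E`, and so is its sum with a multiple of the slack of `x₀`. That sum is a
  -- positive multiple of a slack, so it lies in `F` and forces `E = F`. The resulting `y` vanishes
  -- on all `t • b - A x` and has `⟪y, s⟫ = 1`.
  let T : ((ℝ × X) × ℝ) →ₗ[ℝ] Y :=
    slackMap A b ∘ₗ LinearMap.fst ℝ (ℝ × X) ℝ + (LinearMap.snd ℝ (ℝ × X) ℝ).smulRight s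
  have hT : ∀ q r, T (q, r) = slackMap A b q + r • s := fun q r => rfl
  obtain ⟨y, hy, hyT⟩ := exists_dual_of_isOrderUnit hE.toPointedCone T
    (LinearMap.snd ℝ (ℝ × X) ℝ) (by
    rintro ⟨⟨t, x⟩, r⟩ hmem
    change 0 ≤ r
    rw [hT] at hmem
    have hmemE : slackMap A b (t, x) + r • s ∈ E := hmem
    by_contra! hr
    refine hne (subset_antisymm (hF.isFace.subset_of_isOrderUnit hE.subset
      (s := slackMap A b (t, x) + (|t| + 1) • (b - A x₀)) ⟨?_, ?_⟩ ?_) hFw)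
    · have h1 := hE.add_mem hmemE (hE.add_mem (hE.smul_mem hs.mem (by linarith : 0 ≤ -r))
        (hE.smul_mem (hFw hx₀.mem) (by positivity : 0 ≤ |t| + 1)))
      convert h1 using 1
      module
    · intro e he
      obtain ⟨ε, hε, h⟩ := hs.exists_sub_mem e he
      have hr' : 0 < -r := by linarith
      refine ⟨-r * ε, by positivity, ?_⟩
      have h1 := hE.add_mem hmemE (hE.add_mem (hE.smul_mem h hr'.le)
        (hE.smul_mem (hFw hx₀.mem) (by positivity : 0 ≤ |t| + 1)))
      convert h1 using 1
      module
    · have hpos : 0 < t + (|t| + 1) := by linarith [neg_abs_le t]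
      rw [slackMap_add_smul hpos]
      refine hF.isFace.smul_mem (hF.slack_mem _ ?_) hpos.le
      have h1 := hE.add_mem hmemE (hE.add_mem (hE.smul_mem hs.mem (by linarith : 0 ≤ -r))
        (hE.smul_mem (hFw hx₀.mem) (by positivity : 0 ≤ |t| + 1)))
      have h2 : slackMap A b (t, x) + (|t| + 1) • (b - A x₀) ∈ K := by
        refine hE.subset ?_
        convert h1 using 1
        module
      rw [slackMap_add_smul hpos] at h2
      have h3 := K.smul_mem h2 (inv_nonneg.2 hpos.le)
      rwa [smul_smul, inv_mul_cancel₀ hpos.ne', one_smul] at h3) (0, 1) (by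
    rw [hT, map_zero, zero_add, one_smul]
    exact hs)
  obtain ⟨u, hu, v, hv, rfl⟩ := hK w hw y hy
  refine ⟨u, hu, v, hv, ?_, s, hs.mem, ?_⟩
  · rw [mem_nullL]
    constructor
    · intro x
      have := hyT ((0, -x), 0)
      rw [hT, slackMap_apply, zero_smul, zero_smul, map_neg] at this
      simpa using this
    · have := hyT ((1, 0), 0)
      rw [hT, slackMap_apply, zero_smul, one_smul, map_zero] at this
      simpa using this
  · have := hyT (0, 1)
    rw [hT, map_zero, zero_add, one_smul, inner_add_left, hv s hs.mem, add_zero] at this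
    rw [this]
    exact one_ne_zero

theorem exposedFace_add {w u : Y} (hw : w ∈ dualCone (K : Set Y)) (hu : u ∈ dualCone (K : Set Y)) :
    exposedFace K (w + u) = {x | x ∈ exposedFace K w ∧ ⟪u, x⟫_ℝ = 0} := by
  rw [mem_dualCone] at hw hu
  ext x
  constructor
  · rintro ⟨hx, h⟩
    rw [inner_add_left] at h
    exact ⟨⟨hx, by linarith [hw x hx, hu x hx]⟩, by linarith [hw x hx, hu x hx]⟩
  · rintro ⟨⟨hx, h⟩, h'⟩
    exact ⟨hx, by rw [inner_add_left, h, h', add_zero]⟩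

/-- A vector in `L` that splits into a dual vector and a vector orthogonal to an exposed face
containing `F` vanishes on `F`, and so does its first part. -/
theorem IsSlackFace.inner_eq_zero (hF : IsSlackFace A b K F) {u v : Y}
    (hu : u ∈ dualCone (K : Set Y)) (hv : ∀ x ∈ F, ⟪v, x⟫_ℝ = 0) (huv : u + v ∈ nullL A b) :
    ∀ x ∈ F, ⟪u, x⟫_ℝ = 0 := by
  obtain ⟨x₀, hx₀⟩ := hF.exists_isOrderUnit
  have h0 := inner_slack_of_mem_nullL huv x₀
  rw [inner_add_left, hv _ hx₀.mem, add_zero] at h0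
  -- `u` is nonnegative on `K` and zero at the order unit `b - A x₀`, which dominates a positive
  -- multiple of every `x ∈ F`.
  rw [mem_dualCone] at hu
  intro x hx
  obtain ⟨ε, hε, h⟩ := hx₀.exists_sub_mem x hx
  have h1 := hu _ (hF.isFace.subset h)
  rw [inner_sub_right, h0, real_inner_smul_right] at h1
  have h2 := hu _ (hF.isFace.subset hx)
  nlinarith

/-- Soundness of the extended system, for any number of steps. -/
theorem IsSlackFace.lastSum_mem_dualCone (hF : IsSlackFace A b K F) {ℓ : ℕ}
    {p : (Fin (ℓ + 2) → Y) × (Fin (ℓ + 2) → Y)} (hp : p ∈ extNice A b K ℓ) :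
    lastSum p ∈ dualCone F := by
  obtain ⟨hu0, -, hcone, hnull⟩ := hp
  have hsum : ∀ i, ∑ j ∈ Finset.Iio i, p.1 j ∈ dualCone (K : Set Y) := by
    intro i
    refine Finset.sum_induction _ (· ∈ dualCone (K : Set Y)) (fun _ _ => add_mem_dualCone)
      (zero_mem_dualCone _) fun j _ => ?_
    rcases eq_or_ne j 0 with rfl | hj
    · rw [hu0]
      exact zero_mem_dualCone _
    · exact (hcone j hj).1
  have hv : ∀ i ≠ 0, (∀ j < i, ∀ x ∈ F, ⟪p.1 j, x⟫_ℝ = 0) → ∀ x ∈ F, ⟪p.2 i, x⟫_ℝ = 0 := by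
    intro i hi h x hx
    refine (mem_tangentSpace_dualCone (hsum i)).1 (hcone i hi).2 x ⟨hF.isFace.subset hx, ?_⟩
    rw [sum_inner]
    exact Finset.sum_eq_zero fun j hj => h j (Finset.mem_Iio.1 hj) x hx
  -- If the earlier `u_j` vanish on `F`, then `F` lies in the face exposed by their sum, so `v_i`
  -- vanishes on `F`; membership of `u_i + v_i` in `L` then makes `u_i` vanish there.
  have hu : ∀ i, i ≠ Fin.last (ℓ + 1) → ∀ x ∈ F, ⟪p.1 i, x⟫_ℝ = 0 := by
    intro i
    induction i using WellFoundedLT.induction with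
    | ind i ih =>
      intro hi
      rcases eq_or_ne i 0 with rfl | hi0
      · intro x _
        rw [hu0, inner_zero_left]
      · exact hF.inner_eq_zero (hcone i hi0).1
          (hv i hi0 fun j hj => ih j hj (ne_of_lt (lt_of_lt_of_le hj (Fin.le_last _))))
          (hnull i hi0 hi)
  have hlast : Fin.last (ℓ + 1) ≠ 0 := Fin.last_pos.ne'
  rw [mem_dualCone]
  intro x hx
  rw [lastSum, inner_add_left, hv _ hlast (fun j hj => hu j hj.ne) x hx, add_zero]
  exact mem_dualCone.1 (hcone _ hlast).1 x (hF.isFace.subset hx)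

end Conic

/-! ### Greedy facial reduction and the number of steps. -/

section Completeness

variable {X Y : Type*} [NormedAddCommGroup X] [InnerProductSpace ℝ X] [FiniteDimensional ℝ X]
  [NormedAddCommGroup Y] [InnerProductSpace ℝ Y] [FiniteDimensional ℝ Y]
  {A : X →ₗ[ℝ] Y} {b : Y} {K : ProperCone ℝ Y} {F : Set Y}

theorem sum_Iio_fin_val {N : ℕ} (i : Fin N) (f : ℕ → Y) :
    ∑ j ∈ Finset.Iio i, f (j : ℕ) = ∑ j ∈ Finset.range (i : ℕ), f j := by
  rw [← Nat.Iio_eq_range, ← Fin.map_valEmbedding_Iio, Finset.sum_map]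
  rfl

/-- Turns the reduction sequence, indexed from `0`, into variables of the extended system, where
reductions sit at `1, …, ℓ` and the final splitting at `ℓ + 1`. -/
theorem exists_extend_by_last (u : ℕ → Y) (z : Y) (ℓ : ℕ) :
    ∃ U : ℕ → Y, U 0 = 0 ∧ (∀ i < ℓ, U (i + 1) = u i) ∧ U (ℓ + 1) = z := by
  refine ⟨fun i => if i = 0 then 0 else if i = ℓ + 1 then z else u (i - 1), by simp,
    fun i hi => ?_, by simp⟩
  simp [hi.ne]

/-- The greedy facial reduction sequence: `w i` are the partial sums, `u i + v i` the reducing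
vectors, and each step reduces the exposed face until it equals `F`. -/
theorem IsSlackFace.exists_reduction_sequence (hF : IsSlackFace A b K F)
    (hK : HasFacialSplitting K) :
    ∃ w u v : ℕ → Y, w 0 = 0 ∧ (∀ i, w (i + 1) = w i + u i) ∧
      (∀ i, w i ∈ dualCone (K : Set Y)) ∧ (∀ i, u i ∈ dualCone (K : Set Y)) ∧
      (∀ i, ∀ x ∈ exposedFace K (w i), ⟪v i, x⟫_ℝ = 0) ∧ (∀ i, u i + v i ∈ nullL A b) ∧
      (∀ i, F ⊆ exposedFace K (w i)) ∧
      ∀ i, exposedFace K (w i) ≠ F → ∃ x ∈ exposedFace K (w i), ⟪u i, x⟫_ℝ ≠ 0 := by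
  have step : ∀ w : {w : Y // w ∈ dualCone (K : Set Y) ∧ F ⊆ exposedFace K w},
      ∃ q : Y × Y, q.1 ∈ dualCone (K : Set Y) ∧ (∀ x ∈ exposedFace K (w : Y), ⟪q.2, x⟫_ℝ = 0) ∧
        q.1 + q.2 ∈ nullL A b ∧
        (exposedFace K (w : Y) ≠ F → ∃ x ∈ exposedFace K (w : Y), ⟪q.1, x⟫_ℝ ≠ 0) := by
    rintro ⟨w, hw, hFw⟩
    by_cases h : exposedFace K w = F
    · exact ⟨0, zero_mem_dualCone _, by simp, by simp, fun h' => absurd h h'⟩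
    · obtain ⟨u, hu, v, hv, huv, hx⟩ := hF.exists_reduction hK hw hFw h
      exact ⟨(u, v), hu, hv, huv, fun _ => hx⟩
  choose q hq1 hq2 hq3 hq4 using step
  let next : {w : Y // w ∈ dualCone (K : Set Y) ∧ F ⊆ exposedFace K w} →
      {w : Y // w ∈ dualCone (K : Set Y) ∧ F ⊆ exposedFace K w} := fun w =>
    ⟨w + (q w).1, add_mem_dualCone w.2.1 (hq1 w), by
      rw [exposedFace_add w.2.1 (hq1 w)]
      exact fun x hx => ⟨w.2.2 hx, hF.inner_eq_zero (hq1 w) (fun x hx => hq2 w x (w.2.2 hx))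
        (hq3 w) x hx⟩⟩
  let w₀ : {w : Y // w ∈ dualCone (K : Set Y) ∧ F ⊆ exposedFace K w} :=
    ⟨0, zero_mem_dualCone _, fun x hx => ⟨hF.isFace.subset hx, inner_zero_left _⟩⟩
  let W : ℕ → {w : Y // w ∈ dualCone (K : Set Y) ∧ F ⊆ exposedFace K w} := fun i => next^[i] w₀
  refine ⟨fun i => W i, fun i => (q (W i)).1, fun i => (q (W i)).2, rfl, fun i => ?_,
    fun i => (W i).2.1, fun i => hq1 _, fun i => hq2 _, fun i => hq3 _, fun i => (W i).2.2,
    fun i => hq4 _⟩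
  change ((next^[i + 1] w₀ : {w : Y // _}) : Y) = _
  rw [Function.iterate_succ_apply']

/-- A number of steps that suffices for facial reduction: either it is at least `dim L`, or there
is no longer strictly decreasing sequence of faces exposed by an increasing sequence in `K*`. -/
def IsReductionBound (A : X →ₗ[ℝ] Y) (b : Y) (K : ProperCone ℝ Y) (ℓ : ℕ) : Prop :=
  Module.finrank ℝ (nullL A b) ≤ ℓ ∨
    ∀ w : ℕ → Y, (∀ i, w i ∈ dualCone (K : Set Y)) →
      (∀ i, w (i + 1) - w i ∈ dualCone (K : Set Y)) →
      ¬ ∀ i ≤ ℓ, exposedFace K (w (i + 1)) ⊂ exposedFace K (w i)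

/-- Completeness of the extended system, if the number of steps suffices. -/
theorem IsSlackFace.exists_lastSum_eq (hF : IsSlackFace A b K F) (hK : HasFacialSplitting K)
    {ℓ : ℕ} (hℓ : IsReductionBound A b K ℓ) {y : Y} (hy : y ∈ dualCone F) :
    ∃ p ∈ extNice A b K ℓ, lastSum p = y := by
  obtain ⟨w, u, v, hw0, hws, hw, hu, hv, huv, hFw, hred⟩ := hF.exists_reduction_sequence hK
  have hface : ∀ i, exposedFace K (w (i + 1)) =
      {x | x ∈ exposedFace K (w i) ∧ ⟪u i, x⟫_ℝ = 0} := fun i => by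
    rw [hws, exposedFace_add (hw i) (hu i)]
  have hanti : Antitone fun i => exposedFace K (w i) := antitone_nat_of_succ_le fun i => by
    rw [hface]
    exact fun x hx => hx.1
  have hEF : exposedFace K (w ℓ) = F := by
    by_contra hne
    have hne' : ∀ i ≤ ℓ, exposedFace K (w i) ≠ F := fun i hi h =>
      hne (subset_antisymm (h ▸ hanti hi) (hFw ℓ))
    rcases hℓ with hℓ | hℓ
    · let M : ℕ → Submodule ℝ Y := fun i =>
        nullL A b ⊓ (Submodule.span ℝ (exposedFace K (w i)))ᗮ
      have hM : ∀ i y, y ∈ M i ↔ y ∈ nullL A b ∧ ∀ x ∈ exposedFace K (w i), ⟪y, x⟫_ℝ = 0 := by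
        intro i y
        rw [Submodule.mem_inf, Submodule.mem_orthogonal]
        refine and_congr_right fun _ => ⟨fun h x hx => ?_, fun h x hx => ?_⟩
        · rw [real_inner_comm]
          exact h x (Submodule.subset_span hx)
        · induction hx using Submodule.span_induction with
          | mem x hx => rw [real_inner_comm]; exact h x hx
          | zero => exact inner_zero_left _
          | add x z _ _ hx hz => rw [inner_add_left, hx, hz, add_zero]
          | smul a x _ hx => rw [real_inner_smul_left, hx, mul_zero]
      have hlt : ∀ i ≤ ℓ, M i < M (i + 1) := by
        intro i hi
        refine lt_of_le_of_ne (fun y hy => ?_) fun heq => ?_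
        · rw [hM] at hy ⊢
          exact ⟨hy.1, fun x hx => hy.2 x (hanti (Nat.le_succ i) hx)⟩
        · obtain ⟨x, hx, hux⟩ := hred i (hne' i hi)
          have h1 : u i + v i ∈ M (i + 1) := by
            rw [hM]
            refine ⟨huv i, fun x hx => ?_⟩
            rw [hface] at hx
            rw [inner_add_left, hx.2, hv i x hx.1, add_zero]
          rw [← heq, hM] at h1
          have h2 := h1.2 x hx
          rw [inner_add_left, hv i x hx, add_zero] at h2
          exact hux h2
      have hrank : ∀ i ≤ ℓ + 1, i ≤ Module.finrank ℝ (M i) := by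
        intro i
        induction i with
        | zero => exact fun _ => Nat.zero_le _
        | succ i ih =>
          intro hi
          exact Nat.lt_of_le_of_lt (ih (by omega))
            (Submodule.finrank_lt_finrank_of_lt (hlt i (by omega)))
      have h1 := hrank (ℓ + 1) le_rfl
      have h2 : Module.finrank ℝ (M (ℓ + 1)) ≤ Module.finrank ℝ (nullL A b) :=
        Submodule.finrank_mono inf_le_left
      omega
    · refine hℓ w hw (fun i => by rw [hws, add_sub_cancel_left]; exact hu i) fun i hi => ?_
      refine (hanti (Nat.le_succ i)).ssubset_of_ne fun heq => ?_
      obtain ⟨x, hx, hux⟩ := hred i (hne' i hi)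
      have heq' : exposedFace K (w (i + 1)) = exposedFace K (w i) := heq
      rw [← heq', hface] at hx
      exact hux hx.2
  rw [← hEF] at hy
  -- The face exposed by `w ℓ` is `F` itself, so splitting `y` over it gives the last pair.
  obtain ⟨u', hu', v', hv', rfl⟩ := hK (w ℓ) (hw ℓ) y hy
  obtain ⟨U, hU0, hU, hU'⟩ := exists_extend_by_last u u' ℓ
  obtain ⟨V, hV0, hV, hV'⟩ := exists_extend_by_last v v' ℓ
  have hsum : ∀ i, i ≤ ℓ → ∑ j ∈ Finset.range (i + 1), U j = w i := by
    intro i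
    induction i with
    | zero => intro _; simp [hU0, hw0]
    | succ i ih =>
      intro hi
      rw [Finset.sum_range_succ, ih (by omega), hU i (by omega), hws]
  refine ⟨(fun i => U i, fun i => V i), ⟨hU0, hV0, ?_, ?_⟩, ?_⟩
  · rintro ⟨i, hi⟩ hi0
    have hi0' : i ≠ 0 := fun h => hi0 (Fin.ext h)
    obtain ⟨k, rfl⟩ : ∃ k, i = k + 1 := ⟨i - 1, by omega⟩
    have hs : ∑ j ∈ Finset.Iio (⟨k + 1, hi⟩ : Fin (ℓ + 2)), U j = w k := by
      rw [sum_Iio_fin_val, hsum k (by omega)]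
    dsimp only
    rw [hs, mem_tangentSpace_dualCone (hw k)]
    rcases Nat.lt_or_ge k ℓ with hk | hk
    · rw [hU k hk, hV k hk]
      exact ⟨hu k, hv k⟩
    · obtain rfl : k = ℓ := by omega
      rw [hU', hV']
      exact ⟨hu', hv'⟩
  · rintro ⟨i, hi⟩ hi0 hil
    have hi0' : i ≠ 0 := fun h => hi0 (Fin.ext h)
    have hil' : i ≠ ℓ + 1 := fun h => hil (Fin.ext h)
    obtain ⟨k, rfl⟩ : ∃ k, i = k + 1 := ⟨i - 1, by omega⟩
    dsimp only
    rw [hU k (by omega), hV k (by omega)]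
    exact huv k
  · change U (ℓ + 1) + V (ℓ + 1) = u' + v'
    rw [hU', hV']

theorem IsSlackFace.dualCone_eq_image (hF : IsSlackFace A b K F) (hK : HasFacialSplitting K)
    {ℓ : ℕ} (hℓ : IsReductionBound A b K ℓ) : dualCone F = lastSum '' extNice A b K ℓ := by
  apply subset_antisymm
  · intro y hy
    obtain ⟨p, hp, rfl⟩ := hF.exists_lastSum_eq hK hℓ hy
    exact ⟨p, hp, rfl⟩
  · rintro _ ⟨p, hp, rfl⟩
    exact hF.lastSum_mem_dualCone hp

/-- The number of faces in a chain of faces is at most `dim Y + 1`. -/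
theorem le_of_strictMono_isFace {k : ℕ} {E : Fin k → Set Y} (hE : StrictMono E)
    (hface : ∀ i, IsFace (K : Set Y) (E i)) : k ≤ Module.finrank ℝ Y + 1 := by
  have hmono : StrictMono fun i => Module.finrank ℝ (Submodule.span ℝ (E i)) := by
    intro i j hij
    refine Submodule.finrank_lt_finrank_of_lt
      (lt_of_le_of_ne (Submodule.span_mono (hE hij).le) fun heq => (hE hij).not_ge ?_)
    intro x hx
    refine (hface i).mem_of_mem_span ((hface j).subset hx) ?_
    rw [heq]
    exact Submodule.subset_span hx
  let g : Fin k → Fin (Module.finrank ℝ Y + 1) := fun i =>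
    ⟨_, Nat.lt_succ_of_le (Submodule.finrank_le (Submodule.span ℝ (E i)))⟩
  have hg : Function.Injective g := fun i j h => hmono.injective (Fin.mk.inj_iff.1 h)
  simpa using Fintype.card_le_of_injective g hg

theorem le_faceChainLength {k : ℕ} {E : Fin k → Set Y} (hE : StrictMono E)
    (hface : ∀ i, IsFace (K : Set Y) (E i)) : k ≤ faceChainLength K :=
  le_csSup ⟨Module.finrank ℝ Y + 1, fun _ ⟨_, h, h'⟩ => le_of_strictMono_isFace h h'⟩
    ⟨E, hE, hface⟩

theorem isReductionBound_ell : IsReductionBound A b K (ell A b K) := by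
  rcases min_choice (faceChainLength K - 1) (Module.finrank ℝ (nullL A b)) with h | h
  · right
    intro w hw _ hlt
    have hℓ : ell A b K = faceChainLength K - 1 := h
    set ℓ := ell A b K
    -- Reversed, `ℓ + 1` strict drops form an increasing chain of `ℓ + 2` faces, one more than
    -- `faceChainLength K` permits.
    have hmono : StrictMono fun i : Fin (ℓ + 2) => exposedFace K (w (ℓ + 1 - i)) := by
      refine Fin.strictMono_iff_lt_succ.2 fun i => ?_
      have hi := i.isLt
      have h1 := hlt (ℓ + 1 - (i + 1)) (by omega)
      rw [show ℓ + 1 - (i + 1) + 1 = ℓ + 1 - (i : ℕ) by omega] at h1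
      exact h1
    have := le_faceChainLength hmono fun i => isFace_exposedFace (hw _)
    omega
  · left
    exact h.ge

end Completeness

theorem extendedDual_of_isNice {X Y : Type*} [NormedAddCommGroup X] [InnerProductSpace ℝ X]
    [FiniteDimensional ℝ X] [NormedAddCommGroup Y] [InnerProductSpace ℝ Y] [FiniteDimensional ℝ Y]
    (A : X →ₗ[ℝ] Y) (b : Y) (K : ProperCone ℝ Y) (hK : IsNice K)
    (hfeas : (primalFeas A b K).Nonempty) :
    (∃! F : Set Y, IsMinimalCone A b K F) ∧
      (∀ F : Set Y, IsMinimalCone A b K F →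
        dualCone F = {y | ∃ p ∈ extNice A b K (ell A b K), y = lastSum p}) ∧
      (∀ c : X, StrongDuality (primalFeas A b K) (fun x => ⟪c, x⟫_ℝ)
        (extDualFeas A b c K (ell A b K)) (fun p => ⟪b, lastSum p⟫_ℝ)) := by
  have himage : ∀ F : Set Y, IsMinimalCone A b K F →
      dualCone F = lastSum '' extNice A b K (ell A b K) := fun F hF =>
    hF.isSlackFace.dualCone_eq_image hK.hasFacialSplitting isReductionBound_ell
  have hex := existsUnique_isMinimalCone hfeas
  refine ⟨hex, fun F hF => ?_, fun c => ?_⟩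
  · rw [himage F hF]
    ext y
    simp only [Set.mem_image, Set.mem_ofPred_eq, eq_comm]
  · obtain ⟨F, hF, -⟩ := hex
    exact hF.isSlackFace.strongDuality hfeas c (himage F hF)

/-! ### Positive semidefinite block matrices and compression to a kernel. -/

section MatrixFacts

open Matrix

variable {n : ℕ}

theorem posSemidef_iff_real {M : Matrix (Fin n) (Fin n) ℝ} :
    M.PosSemidef ↔ M.IsSymm ∧ ∀ q : Fin n → ℝ, 0 ≤ q ⬝ᵥ M *ᵥ q := by
  rw [Matrix.posSemidef_iff_dotProduct_mulVec]
  simp only [star_trivial]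
  rfl

theorem mulVec_eq_zero_of_dotProduct {M : Matrix (Fin n) (Fin n) ℝ} (hM : M.PosSemidef)
    {q : Fin n → ℝ} (h : q ⬝ᵥ M *ᵥ q = 0) : M *ᵥ q = 0 :=
  (hM.dotProduct_mulVec_zero_iff q).1 (by rwa [star_trivial])

theorem matInner_vecMulVec (Z : Matrix (Fin n) (Fin n) ℝ) (q : Fin n → ℝ) :
    matInner Z (vecMulVec q q) = q ⬝ᵥ Z *ᵥ q := by
  simp only [matInner, dotProduct, mulVec, vecMulVec_apply, Finset.mul_sum]
  exact Finset.sum_congr rfl fun i _ => Finset.sum_congr rfl fun j _ => by ring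

theorem posSemidef_vecMulVec (q : Fin n → ℝ) : (vecMulVec q q).PosSemidef := by
  simpa using Matrix.posSemidef_vecMulVec_self_star q

open scoped MatrixOrder in
/-- A positive semidefinite matrix is a sum of squares of vectors. -/
theorem exists_matInner_eq_sum {M : Matrix (Fin n) (Fin n) ℝ} (hM : M.PosSemidef) :
    ∃ B : Matrix (Fin n) (Fin n) ℝ, ∀ Z, matInner Z M = ∑ k, B k ⬝ᵥ Z *ᵥ B k := by
  obtain ⟨B, rfl⟩ := CStarAlgebra.nonneg_iff_eq_star_mul_self.mp hM.nonneg
  rw [star_eq_conjTranspose]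
  refine ⟨B, fun Z => ?_⟩
  simp only [matInner, dotProduct, mulVec, mul_apply, conjTranspose_apply, star_trivial,
    Finset.mul_sum]
  rw [Finset.sum_comm' (t' := Finset.univ) (s' := fun _ => Finset.univ) (by simp)]
  rw [Finset.sum_comm]
  refine (Finset.sum_congr rfl fun i _ => Finset.sum_comm).trans ?_
  rw [Finset.sum_comm]
  refine Finset.sum_congr rfl fun k _ => ?_
  refine Finset.sum_congr rfl fun i _ => Finset.sum_congr rfl fun j _ => by ring

/-- The block matrix of the extended dual is positive semidefinite only if the quadratic form of `w`
vanishes on the kernel of the upper left block. -/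
theorem dotProduct_eq_zero_of_fromBlocks {W w : Matrix (Fin n) (Fin n) ℝ} {β : ℝ}
    (h : (fromBlocks W w wᵀ (β • (1 : Matrix (Fin n) (Fin n) ℝ))).PosSemidef) {q : Fin n → ℝ}
    (hq : W *ᵥ q = 0) : q ⬝ᵥ (w + wᵀ) *ᵥ q = 0 := by
  have hT : q ⬝ᵥ wᵀ *ᵥ q = q ⬝ᵥ w *ᵥ q := by
    rw [mulVec_transpose, dotProduct_comm, dotProduct_mulVec]
  -- Testing the block matrix on `(t q, q)` kills the quadratic term in `t`, since `W q = 0`. An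
  -- affine function of `t` bounded below has zero slope; the `t` chosen below would make it `-1`.
  have key : ∀ t : ℝ, 0 ≤ 2 * t * (q ⬝ᵥ w *ᵥ q) + β * (q ⬝ᵥ q) := by
    intro t
    have h1 := h.dotProduct_mulVec_nonneg (Sum.elim (t • q) q)
    rw [star_trivial, fromBlocks_mulVec] at h1
    simp only [Sum.elim_comp_inl, Sum.elim_comp_inr, sumElim_dotProduct_sumElim, mulVec_smul, hq,
      smul_zero, zero_add, smul_mulVec, one_mulVec, dotProduct_add, smul_dotProduct,
      dotProduct_smul, hT, smul_eq_mul] at h1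
    linarith
  rw [add_mulVec, dotProduct_add, hT]
  by_contra hne
  set a := q ⬝ᵥ w *ᵥ q
  have ha : a ≠ 0 := fun h => hne (by rw [h, add_zero])
  have := key (-(β * (q ⬝ᵥ q) + 1) / (2 * a))
  have h2 : 2 * (-(β * (q ⬝ᵥ q) + 1) / (2 * a)) * a = -(β * (q ⬝ᵥ q) + 1) := by
    field_simp
  rw [h2] at this
  linarith

theorem exists_dotProduct_le (T : Matrix (Fin n) (Fin n) ℝ) :
    ∃ β : ℝ, ∀ y : Fin n → ℝ, y ⬝ᵥ T *ᵥ y ≤ β * (y ⬝ᵥ y) := by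
  refine ⟨∑ i, ∑ j, |T i j|, fun y => ?_⟩
  simp only [dotProduct, mulVec, Finset.mul_sum (s := Finset.univ), Finset.sum_mul]
  rw [show (∑ k, ∑ i, ∑ j, |T i j| * (y k * y k)) = ∑ i, ∑ j, ∑ k, |T i j| * (y k * y k) by
    rw [Finset.sum_comm]
    exact Finset.sum_congr rfl fun i _ => Finset.sum_comm]
  refine Finset.sum_le_sum fun i _ => Finset.sum_le_sum fun j _ => ?_
  rw [← Finset.mul_sum]
  have hle : ∀ k, y k * y k ≤ ∑ k, y k * y k := fun k =>
    Finset.single_le_sum (f := fun k => y k * y k) (fun k _ => mul_self_nonneg _)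
      (Finset.mem_univ k)
  have hij : |y i * y j| ≤ ∑ k, y k * y k := by
    rw [abs_le]
    constructor <;> nlinarith [hle i, hle j, sq_nonneg (y i + y j), sq_nonneg (y i - y j)]
  calc y i * (T i j * y j) = T i j * (y i * y j) := by ring
    _ ≤ |T i j * (y i * y j)| := le_abs_self _
    _ = |T i j| * |y i * y j| := abs_mul _ _
    _ ≤ _ := mul_le_mul_of_nonneg_left hij (abs_nonneg _)

/-- Completing the square, the form at `(x, y)` is that of `W` at `x + N y` plus `β |y|²` minus that
of `Nᵀ W N` at `y`; a large `β` makes the remainder nonnegative. -/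
theorem exists_posSemidef_fromBlocks {W : Matrix (Fin n) (Fin n) ℝ} (hW : W.PosSemidef)
    (N : Matrix (Fin n) (Fin n) ℝ) :
    ∃ β : ℝ, (fromBlocks W (W * N) (W * N)ᵀ (β • (1 : Matrix (Fin n) (Fin n) ℝ))).PosSemidef := by
  obtain ⟨β, hβ⟩ := exists_dotProduct_le (Nᵀ * W * N)
  refine ⟨β, Matrix.PosSemidef.of_dotProduct_mulVec_nonneg ?_ fun z => ?_⟩
  · rw [Matrix.isHermitian_fromBlocks_iff]
    refine ⟨hW.isHermitian, ?_, ?_, ?_⟩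
    · rw [conjTranspose_eq_transpose_of_trivial]
    · rw [conjTranspose_eq_transpose_of_trivial, transpose_transpose]
    · simp [Matrix.IsHermitian]
  · obtain ⟨x, y, rfl⟩ : ∃ x y, z = Sum.elim x y :=
      ⟨z ∘ Sum.inl, z ∘ Sum.inr, (Sum.elim_comp_inl_inr z).symm⟩
    have hWs : Wᵀ = W := (posSemidef_iff_real.1 hW).1
    have h1 := (posSemidef_iff_real.1 hW).2 (x + N *ᵥ y)
    have h2 := hβ y
    rw [star_trivial, fromBlocks_mulVec]
    simp only [Sum.elim_comp_inl, Sum.elim_comp_inr, sumElim_dotProduct_sumElim, smul_mulVec,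
      one_mulVec, dotProduct_add, dotProduct_smul, smul_eq_mul, transpose_mul, hWs]
    have e1 : x ⬝ᵥ (W * N) *ᵥ y = x ⬝ᵥ W *ᵥ (N *ᵥ y) := by rw [mulVec_mulVec]
    have e2 : y ⬝ᵥ (Nᵀ * W) *ᵥ x = (N *ᵥ y) ⬝ᵥ W *ᵥ x := by
      rw [← mulVec_mulVec, mulVec_transpose, dotProduct_comm, ← dotProduct_mulVec, dotProduct_comm]
    have e3 : y ⬝ᵥ (Nᵀ * W * N) *ᵥ y = (N *ᵥ y) ⬝ᵥ W *ᵥ (N *ᵥ y) := by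
      rw [← mulVec_mulVec, ← mulVec_mulVec, mulVec_transpose, dotProduct_comm, ← dotProduct_mulVec,
        dotProduct_comm]
    rw [e1, e2]
    rw [e3] at h2
    simp only [mulVec_add, dotProduct_add, add_dotProduct] at h1
    linarith

/-- The orthogonal projection `P` to the kernel of a symmetric matrix `W`, and a generalized inverse
`M` with `P + W M = 1`. -/
theorem exists_ker_projection {W : Matrix (Fin n) (Fin n) ℝ} (hW : W.IsSymm) :
    ∃ P M : Matrix (Fin n) (Fin n) ℝ, P.IsSymm ∧ W * P = 0 ∧ P + W * M = 1 := by
  have hsa : IsSelfAdjoint W := hW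
  have hc : ∀ f : ℝ → ℝ, ContinuousOn f (spectrum ℝ W) := fun f =>
    (Matrix.finite_real_spectrum (A := W)).continuousOn f
  have hid : cfc (fun x : ℝ => x) W = W := cfc_id' ℝ W
  -- The convention `0⁻¹ = 0` makes the second function a generalized inverse. The discontinuities
  -- at `0` are harmless because the spectrum is finite.
  refine ⟨cfc (fun x : ℝ => if x = 0 then 1 else 0) W, cfc (fun x : ℝ => x⁻¹) W, ?_, ?_, ?_⟩
  · exact cfc_predicate (p := IsSelfAdjoint) _ W
  · nth_rewrite 1 [← hid]
    rw [← cfc_mul _ _ W (hc _) (hc _), ← cfc_zero ℝ W]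
    congr 1
    ext x
    by_cases hx : x = 0 <;> simp [hx]
  · nth_rewrite 2 [← hid]
    rw [← cfc_mul _ _ W (hc _) (hc _), ← cfc_add W _ _ (hc _) (hc _), ← cfc_one ℝ W]
    congr 1
    ext x
    by_cases hx : x = 0 <;> simp [hx]

/-- A symmetric matrix, up to its compression to the kernel of `W`, is `w + wᵀ` for an off-diagonal
block `w` of a positive semidefinite block matrix with upper left block `W`. -/
theorem exists_compression_add {W Z : Matrix (Fin n) (Fin n) ℝ} (hW : W.PosSemidef)
    (hZ : Z.IsSymm) :
    ∃ P w : Matrix (Fin n) (Fin n) ℝ, ∃ β : ℝ, P.IsSymm ∧ W * P = 0 ∧ Z = P * Z * P + (w + wᵀ) ∧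
      (fromBlocks W w wᵀ (β • (1 : Matrix (Fin n) (Fin n) ℝ))).PosSemidef := by
  obtain ⟨P, M, hP, hWP, hPM⟩ := exists_ker_projection (posSemidef_iff_real.1 hW).1
  -- With `Q = 1 - P = W M` the off-diagonal block is `w = Q Z (1 - Q / 2)`, so `w + wᵀ = Q Z + Z Q
  -- - Q Z Q = Z - P Z P`.
  obtain ⟨β, hβ⟩ := exists_posSemidef_fromBlocks hW (M * Z * (1 - (2⁻¹ : ℝ) • (1 - P)))
  have hWM : W * M = 1 - P := by rw [← hPM, add_sub_cancel_left]
  refine ⟨P, _, β, hP, hWP, ?_, hβ⟩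
  have hP' : Pᵀ = P := hP
  have hZ' : Zᵀ = Z := hZ
  have e : W * (M * Z * (1 - (2⁻¹ : ℝ) • (1 - P))) = (1 - P) * Z * (1 - (2⁻¹ : ℝ) • (1 - P)) := by
    rw [← Matrix.mul_assoc, ← Matrix.mul_assoc, hWM]
  rw [e]
  simp only [transpose_mul, transpose_sub, transpose_smul, hP', hZ', Matrix.mul_sub,
    Matrix.sub_mul, Matrix.mul_one, Matrix.one_mul, Matrix.mul_smul, Matrix.mul_assoc]
  module

theorem dotProduct_mul_mul_self {P Z : Matrix (Fin n) (Fin n) ℝ} (hP : P.IsSymm) (q : Fin n → ℝ) :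
    q ⬝ᵥ (P * Z * P) *ᵥ q = (P *ᵥ q) ⬝ᵥ Z *ᵥ (P *ᵥ q) := by
  have hP' : Pᵀ = P := hP
  rw [← mulVec_mulVec, ← mulVec_mulVec]
  nth_rewrite 1 [← hP']
  rw [mulVec_transpose, dotProduct_comm, ← dotProduct_mulVec, dotProduct_comm]

theorem isSymm_mul_mul_self {P Z : Matrix (Fin n) (Fin n) ℝ} (hP : P.IsSymm) (hZ : Z.IsSymm) :
    (P * Z * P).IsSymm := by
  have hP' : Pᵀ = P := hP
  have hZ' : Zᵀ = Z := hZ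
  rw [Matrix.IsSymm, transpose_mul, transpose_mul, hP', hZ', Matrix.mul_assoc]

theorem mulVec_mulVec_eq_zero {W P : Matrix (Fin n) (Fin n) ℝ} (h : W * P = 0) (q : Fin n → ℝ) :
    W *ᵥ (P *ᵥ q) = 0 := by rw [mulVec_mulVec, h, zero_mulVec]

/-- A matrix whose quadratic form is nonnegative on the kernel of `W` splits into a positive
semidefinite matrix and a matrix of the form `w + wᵀ`. -/
theorem exists_posSemidef_add {W Z : Matrix (Fin n) (Fin n) ℝ} (hW : W.PosSemidef)
    (hZ : Z.IsSymm) (h : ∀ q, W *ᵥ q = 0 → 0 ≤ q ⬝ᵥ Z *ᵥ q) :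
    ∃ U w : Matrix (Fin n) (Fin n) ℝ, ∃ β : ℝ, U.PosSemidef ∧ Z = U + (w + wᵀ) ∧
      (fromBlocks W w wᵀ (β • (1 : Matrix (Fin n) (Fin n) ℝ))).PosSemidef := by
  obtain ⟨P, w, β, hP, hWP, hdec, hβ⟩ := exists_compression_add hW hZ
  refine ⟨_, w, β, posSemidef_iff_real.2 ⟨isSymm_mul_mul_self hP hZ, fun q => ?_⟩, hdec, hβ⟩
  rw [dotProduct_mul_mul_self hP]
  exact h _ (mulVec_mulVec_eq_zero hWP q)

/-- A matrix whose quadratic form vanishes on the kernel of `W` is of the form `w + wᵀ`. -/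
theorem exists_eq_add_transpose {W Z : Matrix (Fin n) (Fin n) ℝ} (hW : W.PosSemidef)
    (hZ : Z.IsSymm) (h : ∀ q, W *ᵥ q = 0 → q ⬝ᵥ Z *ᵥ q = 0) :
    ∃ w : Matrix (Fin n) (Fin n) ℝ, ∃ β : ℝ, Z = w + wᵀ ∧
      (fromBlocks W w wᵀ (β • (1 : Matrix (Fin n) (Fin n) ℝ))).PosSemidef := by
  obtain ⟨P, w, β, hP, hWP, hdec, hβ⟩ := exists_compression_add hW hZ
  have h0 : ∀ q, q ⬝ᵥ (P * Z * P) *ᵥ q = 0 := fun q => by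
    rw [dotProduct_mul_mul_self hP]
    exact h _ (mulVec_mulVec_eq_zero hWP q)
  have hpsd : (P * Z * P).PosSemidef :=
    posSemidef_iff_real.2 ⟨isSymm_mul_mul_self hP hZ, fun q => (h0 q).ge⟩
  have hzero : P * Z * P = 0 := by
    refine Matrix.ext_of_mulVec_single fun i => ?_
    rw [mulVec_eq_zero_of_dotProduct hpsd (h0 _), zero_mulVec]
  rw [hzero, zero_add] at hdec
  exact ⟨w, β, hdec, hβ⟩

end MatrixFacts

/-! ### The positive semidefinite cone in the Euclidean space of symmetric matrices. -/

section SymmetricMatrices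

open Matrix

variable {n : ℕ}

/-- The Euclidean space of symmetric `n × n` matrices. -/
abbrev SymSpace (n : ℕ) : Type :=
  ↥({ carrier := {x | ∀ i j, x (i, j) = x (j, i)}
      add_mem' := fun {x y} hx hy i j => by
        rw [PiLp.add_apply, PiLp.add_apply, hx i j, hy i j]
      zero_mem' := fun _ _ => rfl
      smul_mem' := fun c x hx i j => by
        rw [PiLp.smul_apply, PiLp.smul_apply, hx i j] } :
    Submodule ℝ (EuclideanSpace ℝ (Fin n × Fin n)))

/-- The matrix of an element of `SymSpace n`. -/
def toMat : SymSpace n →ₗ[ℝ] Matrix (Fin n) (Fin n) ℝ where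
  toFun x := Matrix.of fun i j => x.1 (i, j)
  map_add' _ _ := rfl
  map_smul' _ _ := rfl

theorem toMat_apply (x : SymSpace n) (i j : Fin n) : toMat x i j = x.1 (i, j) := rfl

theorem isSymm_toMat (x : SymSpace n) : (toMat x).IsSymm := by
  ext i j
  exact x.2 j i

theorem toMat_injective : Function.Injective (toMat (n := n)) := by
  intro x y h
  ext p
  exact congrFun (congrFun h p.1) p.2

theorem exists_toMat_eq {M : Matrix (Fin n) (Fin n) ℝ} (hM : M.IsSymm) :
    ∃ x : SymSpace n, toMat x = M :=
  ⟨⟨WithLp.toLp 2 fun p => M p.1 p.2, fun i j => hM.apply j i⟩, rfl⟩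

theorem inner_symSpace (x y : SymSpace n) : ⟪x, y⟫_ℝ = matInner (toMat x) (toMat y) := by
  rw [Submodule.coe_inner, PiLp.inner_apply, Fintype.sum_prod_type]
  refine Finset.sum_congr rfl fun i _ => Finset.sum_congr rfl fun j _ => ?_
  rw [toMat_apply, toMat_apply, real_inner_eq_re_inner, RCLike.inner_apply]
  simp [mul_comm]

theorem finrank_symSpace_le : Module.finrank ℝ (SymSpace n) ≤ n * (n + 1) / 2 := by
  -- A symmetric matrix is a function on unordered pairs of indices, of which there are `n (n + 1) /
  -- 2`.
  let f : SymSpace n →ₗ[ℝ] (Sym2 (Fin n) → ℝ) :=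
    { toFun := fun x => Sym2.lift ⟨fun i j => x.1 (i, j), fun i j => x.2 i j⟩
      map_add' := fun x y => by
        ext s
        induction s with | h i j => rfl
      map_smul' := fun c x => by
        ext s
        induction s with | h i j => rfl }
  have hf : Function.Injective f := by
    intro x y h
    ext ⟨i, j⟩
    exact congrFun h s(i, j)
  have h := LinearMap.finrank_le_finrank_of_injective hf
  rw [Module.finrank_fintype_fun_eq_card, Sym2.card, Fintype.card_fin, Nat.choose_two_right,
    Nat.add_sub_cancel, mul_comm] at h
  exact h

/-- The cone of positive semidefinite matrices. -/
def psdCone (n : ℕ) : ProperCone ℝ (SymSpace n) where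
  toSubmodule := PointedCone.ofConeComb {x | (toMat x).PosSemidef}
    ⟨0, by
      change (toMat 0).PosSemidef
      rw [map_zero]
      exact Matrix.PosSemidef.zero⟩
    fun x hx y hy a ha b hb => by
      change (toMat (a • x + b • y)).PosSemidef
      rw [map_add, map_smul, map_smul]
      exact (Matrix.PosSemidef.smul hx ha).add (Matrix.PosSemidef.smul hy hb)
  isClosed' := by
    change IsClosed {x : SymSpace n | (toMat x).PosSemidef}
    have : {x : SymSpace n | (toMat x).PosSemidef} =
        ⋂ q : Fin n → ℝ, {x | 0 ≤ q ⬝ᵥ toMat x *ᵥ q} := by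
      ext x
      simp only [Set.mem_ofPred_eq, Set.mem_iInter, posSemidef_iff_real, isSymm_toMat, true_and]
    rw [this]
    refine isClosed_iInter fun q => isClosed_le continuous_const ?_
    have hc : Continuous (toMat (n := n)) := by
      refine continuous_matrix fun i j => ?_
      simp only [toMat_apply]
      fun_prop
    fun_prop

theorem mem_psdCone {x : SymSpace n} : x ∈ psdCone n ↔ (toMat x).PosSemidef := Iff.rfl

theorem exists_toMat_eq_vecMulVec (q : Fin n → ℝ) :
    ∃ x ∈ psdCone n, toMat x = vecMulVec q q := by
  obtain ⟨x, hx⟩ := exists_toMat_eq (posSemidef_iff_real.1 (posSemidef_vecMulVec q)).1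
  exact ⟨x, mem_psdCone.2 (hx ▸ posSemidef_vecMulVec q), hx⟩

/-- The cone of positive semidefinite matrices is self-dual. -/
theorem mem_dualCone_psdCone {x : SymSpace n} :
    x ∈ dualCone (psdCone n : Set (SymSpace n)) ↔ (toMat x).PosSemidef := by
  rw [mem_dualCone]
  constructor
  · refine fun h => posSemidef_iff_real.2 ⟨isSymm_toMat x, fun q => ?_⟩
    obtain ⟨y, hy, hyq⟩ := exists_toMat_eq_vecMulVec q
    have := h y hy
    rwa [inner_symSpace, hyq, matInner_vecMulVec] at this
  · intro hx y hy
    obtain ⟨B, hB⟩ := exists_matInner_eq_sum (mem_psdCone.1 hy)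
    rw [inner_symSpace, hB]
    exact Finset.sum_nonneg fun k _ => (posSemidef_iff_real.1 hx).2 _

theorem exists_mem_exposedFace {w : SymSpace n} {q : Fin n → ℝ} (hq : toMat w *ᵥ q = 0) :
    ∃ x ∈ exposedFace (psdCone n) w, toMat x = vecMulVec q q := by
  obtain ⟨x, hx, hxq⟩ := exists_toMat_eq_vecMulVec q
  refine ⟨x, ⟨hx, ?_⟩, hxq⟩
  rw [inner_symSpace, hxq, matInner_vecMulVec, hq, dotProduct_zero]

/-- The elements of an exposed face are sums of squares of vectors in the kernel. -/
theorem exists_inner_eq_sum {w x : SymSpace n} (hw : w ∈ dualCone (psdCone n : Set (SymSpace n)))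
    (hx : x ∈ exposedFace (psdCone n) w) :
    ∃ B : Matrix (Fin n) (Fin n) ℝ, (∀ k, toMat w *ᵥ B k = 0) ∧
      ∀ z : SymSpace n, ⟪z, x⟫_ℝ = ∑ k, B k ⬝ᵥ toMat z *ᵥ B k := by
  rw [mem_dualCone_psdCone] at hw
  obtain ⟨B, hB⟩ := exists_matInner_eq_sum (mem_psdCone.1 hx.1)
  refine ⟨B, fun k => mulVec_eq_zero_of_dotProduct hw ?_, fun z => by rw [inner_symSpace, hB]⟩
  have h := hx.2
  rw [inner_symSpace, hB] at h
  exact (Finset.sum_eq_zero_iff_of_nonneg fun k _ => (posSemidef_iff_real.1 hw).2 _).1 h k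
    (Finset.mem_univ k)

theorem mem_dualCone_exposedFace {w z : SymSpace n}
    (hz : z ∈ dualCone (exposedFace (psdCone n) w)) {q : Fin n → ℝ} (hq : toMat w *ᵥ q = 0) :
    0 ≤ q ⬝ᵥ toMat z *ᵥ q := by
  obtain ⟨x, hx, hxq⟩ := exists_mem_exposedFace hq
  have := mem_dualCone.1 hz x hx
  rwa [inner_symSpace, hxq, matInner_vecMulVec] at this

/-- The orthogonal complement of an exposed face of the cone of positive semidefinite matrices, in
terms of block matrices. -/
theorem forall_exposedFace_inner_eq_zero_iff {w v : SymSpace n}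
    (hw : w ∈ dualCone (psdCone n : Set (SymSpace n))) :
    (∀ x ∈ exposedFace (psdCone n) w, ⟪v, x⟫_ℝ = 0) ↔
      ∃ (N : Matrix (Fin n) (Fin n) ℝ) (β : ℝ), toMat v = N + Nᵀ ∧
        (fromBlocks (toMat w) N Nᵀ (β • (1 : Matrix (Fin n) (Fin n) ℝ))).PosSemidef := by
  constructor
  · refine fun h => exists_eq_add_transpose (mem_dualCone_psdCone.1 hw) (isSymm_toMat v)
      fun q hq => ?_
    obtain ⟨x, hx, hxq⟩ := exists_mem_exposedFace hq
    have := h x hx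
    rwa [inner_symSpace, hxq, matInner_vecMulVec] at this
  · rintro ⟨N, β, hv, hβ⟩ x hx
    obtain ⟨B, hB, hsum⟩ := exists_inner_eq_sum hw hx
    rw [hsum, hv]
    exact Finset.sum_eq_zero fun k _ => dotProduct_eq_zero_of_fromBlocks hβ (hB k)

/-- Obtained directly, without `IsNice`: the compression of `y` to the kernel of `w` is the positive
semidefinite part, and the rest has the form `N + Nᵀ`. -/
theorem hasFacialSplitting_psdCone : HasFacialSplitting (psdCone n) := by
  intro w hw y hy
  obtain ⟨U, N, β, hU, hy', hβ⟩ := exists_posSemidef_add (mem_dualCone_psdCone.1 hw)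
    (isSymm_toMat y) fun q hq => mem_dualCone_exposedFace hy hq
  obtain ⟨u, rfl⟩ := exists_toMat_eq (posSemidef_iff_real.1 hU).1
  refine ⟨u, mem_dualCone_psdCone.2 hU, y - u, ?_, by abel⟩
  rw [forall_exposedFace_inner_eq_zero_iff hw]
  exact ⟨N, β, by rw [map_sub, hy', add_sub_cancel_left], hβ⟩

/-- A strictly decreasing sequence of faces of the cone of positive semidefinite matrices, exposed
by an increasing sequence, has at most `n + 1` terms. -/
theorem not_forall_exposedFace_psdCone_ssubset (w : ℕ → SymSpace n)
    (hw : ∀ i, w i ∈ dualCone (psdCone n : Set (SymSpace n)))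
    (hdiff : ∀ i, w (i + 1) - w i ∈ dualCone (psdCone n : Set (SymSpace n))) :
    ¬ ∀ i ≤ n, exposedFace (psdCone n) (w (i + 1)) ⊂ exposedFace (psdCone n) (w i) := by
  intro hlt
  let k : ℕ → Submodule ℝ (Fin n → ℝ) := fun i => LinearMap.ker (toMat (w i)).mulVecLin
  have hk : ∀ i q, q ∈ k i ↔ toMat (w i) *ᵥ q = 0 := fun i q => Iff.rfl
  -- Kernels shrink as the matrices increase. Since the kernel determines the exposed face, each
  -- strict drop of faces is a strict drop of kernels, and at most `n` of these fit in dimension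
  -- `n`.
  have hle : ∀ i, k (i + 1) ≤ k i := by
    intro i q hq
    rw [hk] at hq ⊢
    have h1 := posSemidef_iff_real.1 (mem_dualCone_psdCone.1 (hw i))
    have h2 := posSemidef_iff_real.1 (mem_dualCone_psdCone.1 (hdiff i))
    refine mulVec_eq_zero_of_dotProduct (mem_dualCone_psdCone.1 (hw i))
      (le_antisymm ?_ (h1.2 q))
    have h3 := h2.2 q
    rw [map_sub, sub_mulVec, hq, zero_sub, dotProduct_neg] at h3
    linarith
  have hklt : ∀ i ≤ n, k (i + 1) < k i := by
    refine fun i hi => lt_of_le_of_ne (hle i) fun heq => (hlt i hi).not_subset fun x hx => ?_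
    obtain ⟨B, hB, hsum⟩ := exists_inner_eq_sum (hw i) hx
    refine ⟨hx.1, ?_⟩
    rw [hsum]
    refine Finset.sum_eq_zero fun j _ => ?_
    have : B j ∈ k (i + 1) := heq ▸ hB j
    rw [(hk _ _).1 this, dotProduct_zero]
  have hrank : ∀ i ≤ n + 1, Module.finrank ℝ (k i) + i ≤ n := by
    intro i
    induction i with
    | zero =>
      intro _
      simpa using Submodule.finrank_le (k 0)
    | succ i ih =>
      intro hi
      have h1 := ih (by omega)
      have h2 := Submodule.finrank_lt_finrank_of_lt (hklt i (by omega))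
      omega
  have := hrank (n + 1) le_rfl
  omega

end SymmetricMatrices

/-! ### Translation to the explicit semidefinite dual. -/

section SDP

open Matrix

variable {n m : ℕ}

/-- The linear map `x ↦ ∑ x_k a_k`. -/
noncomputable def combMap (a : Fin m → SymSpace n) : EuclideanSpace ℝ (Fin m) →ₗ[ℝ] SymSpace n :=
  Fintype.linearCombination ℝ a ∘ₗ (WithLp.linearEquiv 2 ℝ (Fin m → ℝ)).toLinearMap

theorem combMap_apply (a : Fin m → SymSpace n) (x : EuclideanSpace ℝ (Fin m)) :
    combMap a x = ∑ k, x k • a k := rfl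

theorem combMap_single (a : Fin m → SymSpace n) (k : Fin m) :
    combMap a (EuclideanSpace.single k 1) = a k := by
  rw [combMap_apply, Finset.sum_eq_single k]
  · simp
  · intro j _ hj
    simp [hj]
  · simp

theorem adjoint_combMap_apply (a : Fin m → SymSpace n) (y : SymSpace n) (k : Fin m) :
    LinearMap.adjoint (combMap a) y k = matInner (toMat (a k)) (toMat y) := by
  have h := LinearMap.adjoint_inner_right (combMap a) (EuclideanSpace.single k (1 : ℝ)) y
  rw [combMap_single, inner_symSpace] at h
  rw [← h, EuclideanSpace.inner_single_left]
  simp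

theorem mem_nullL_combMap {a : Fin m → SymSpace n} {b y : SymSpace n} :
    y ∈ nullL (combMap a) b ↔
      (∀ k, matInner (toMat (a k)) (toMat y) = 0) ∧ matInner (toMat b) (toMat y) = 0 := by
  unfold nullL
  rw [Submodule.mem_inf, LinearMap.mem_ker, LinearMap.mem_ker, innerₗ_apply_apply, inner_symSpace]
  refine and_congr_left fun _ => ⟨fun h k => ?_, fun h => ?_⟩
  · rw [← adjoint_combMap_apply, h]
    rfl
  · ext k
    rw [adjoint_combMap_apply, h]
    rfl

theorem finrank_nullL_combMap_add_le (a : Fin m → SymSpace n) (b : SymSpace n) :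
    Module.finrank ℝ (nullL (combMap a) b) +
      Module.finrank ℝ (Submodule.span ℝ (insert b (Set.range a))) ≤ n * (n + 1) / 2 := by
  have h1 : nullL (combMap a) b ≤ (Submodule.span ℝ (insert b (Set.range a)))ᗮ := by
    intro y hy
    rw [mem_nullL_combMap] at hy
    rw [Submodule.mem_orthogonal]
    intro z hz
    induction hz using Submodule.span_induction with
    | mem z hz =>
      rw [inner_symSpace]
      rcases hz with rfl | ⟨k, rfl⟩
      · exact hy.2
      · exact hy.1 k
    | zero => exact inner_zero_left _
    | add x z _ _ hx hz => rw [inner_add_left, hx, hz, add_zero]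
    | smul c x _ hx => rw [real_inner_smul_left, hx, mul_zero]
  have h2 := Submodule.finrank_mono h1
  have h3 := Submodule.finrank_add_finrank_orthogonal (Submodule.span ℝ (insert b (Set.range a)))
  have h4 := finrank_symSpace_le (n := n)
  omega

theorem isReductionBound_min {a : Fin m → SymSpace n} {b : SymSpace n} {d : ℕ}
    (hd : Module.finrank ℝ (nullL (combMap a) b) ≤ d) :
    IsReductionBound (combMap a) b (psdCone n) (min n d) := by
  rcases min_choice n d with h | h
  · rw [h]
    exact Or.inr not_forall_exposedFace_psdCone_ssubset
  · rw [h]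
    exact Or.inl hd

/-- Strong duality depends only on the sets of objective values. The explicit dual carries auxiliary
`w_i` and `β_i` that are not unique, so comparing values avoids a bijection of feasible sets. -/
theorem StrongDuality.congr {α α' β β' : Type*} {P : Set α} {fP : α → ℝ} {D : Set β} {fD : β → ℝ}
    {P' : Set α'} {fP' : α' → ℝ} {D' : Set β'} {fD' : β' → ℝ} (h : StrongDuality P fP D fD)
    (hP : fP '' P = fP' '' P') (hD : fD '' D = fD' '' D') : StrongDuality P' fP' D' fD' := by
  have hne : D'.Nonempty ↔ D.Nonempty := by
    rw [← Set.image_nonempty (f := fD'), ← hD, Set.image_nonempty]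
  unfold StrongDuality at h ⊢
  rwa [hne, ← hP, ← hD]

theorem toMat_lastSum {ℓ : ℕ} (q : (Fin (ℓ + 2) → SymSpace n) × (Fin (ℓ + 2) → SymSpace n)) :
    toMat (lastSum q) = toMat (q.1 (Fin.last (ℓ + 1))) + toMat (q.2 (Fin.last (ℓ + 1))) :=
  map_add _ _ _

theorem partialSum_mem_dualCone {ℓ : ℕ} {U : Fin (ℓ + 2) → SymSpace n} (hU0 : U 0 = 0)
    (hU : ∀ i : Fin (ℓ + 1), (toMat (U i.succ)).PosSemidef) (i : Fin (ℓ + 2)) :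
    ∑ j ∈ Finset.Iio i, U j ∈ dualCone (psdCone n : Set (SymSpace n)) := by
  refine Finset.sum_induction _ (· ∈ dualCone (psdCone n : Set (SymSpace n)))
    (fun _ _ => add_mem_dualCone) (zero_mem_dualCone _) fun j _ => ?_
  cases j using Fin.cases with
  | zero =>
    rw [hU0]
    exact zero_mem_dualCone _
  | succ j => exact mem_dualCone_psdCone.2 (hU j)

/-- The explicit extended dual has the same objective values as the abstract one. -/
theorem image_sdpExtFeasible (a : Fin m → SymSpace n) (b : SymSpace n) (c : Fin m → ℝ) (ℓ : ℕ) :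
    (fun q => ⟪b, lastSum q⟫_ℝ) ''
        {q | LinearMap.adjoint (combMap a) (lastSum q) = WithLp.toLp 2 c ∧
        q ∈ extNice (combMap a) b (psdCone n) ℓ} =
      (fun p : SDPExtVar n ℓ => matInner (toMat b) p.lastSum) ''
        {p | SDPExtFeasible (fun k => toMat (a k)) (toMat b) c ℓ p} := by
  have hobj : ∀ y : SymSpace n, LinearMap.adjoint (combMap a) y = WithLp.toLp 2 c ↔
      ∀ k, matInner (toMat (a k)) (toMat y) = c k := by
    intro y
    constructor
    · intro h k
      rw [← adjoint_combMap_apply, h]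
    · intro h
      ext k
      rw [adjoint_combMap_apply, h]
  apply subset_antisymm
  · rintro _ ⟨⟨U, V⟩, ⟨hobjq, hU0, hV0, hcone, hnull⟩, rfl⟩
    dsimp only at hU0 hV0 hcone hnull
    have hpsd : ∀ i : Fin (ℓ + 1), (toMat (U i.succ)).PosSemidef := fun i =>
      mem_dualCone_psdCone.1 (hcone i.succ (Fin.succ_ne_zero i)).1
    have hex : ∀ i : Fin (ℓ + 1), ∃ (N : Matrix (Fin n) (Fin n) ℝ) (β : ℝ),
        toMat (V i.succ) = N + Nᵀ ∧ (fromBlocks (∑ j ∈ Finset.Iio i.succ, toMat (U j)) N Nᵀ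
          (β • (1 : Matrix (Fin n) (Fin n) ℝ))).PosSemidef := by
      intro i
      have hs := partialSum_mem_dualCone hU0 hpsd i.succ
      have h := (mem_tangentSpace_dualCone hs).1 (hcone i.succ (Fin.succ_ne_zero i)).2
      rw [forall_exposedFace_inner_eq_zero_iff hs, map_sum] at h
      exact h
    choose N β hN hβ using hex
    refine ⟨⟨fun i => toMat (U i), fun i => toMat (V i), N, β⟩, ?_, ?_⟩
    · refine ⟨?_, ?_, ?_, hpsd, hβ, hN, ?_, ?_⟩
      · intro k
        have := (hobj _).1 hobjq k
        rw [toMat_lastSum] at this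
        exact this
      · intro i hi hil k
        have := (mem_nullL_combMap.1 (hnull i hi hil)).1 k
        rwa [map_add] at this
      · intro i hi hil
        have := (mem_nullL_combMap.1 (hnull i hi hil)).2
        rwa [map_add] at this
      · change toMat (U 0) = 0
        rw [hU0, map_zero]
      · change toMat (V 0) = 0
        rw [hV0, map_zero]
    · dsimp only
      rw [inner_symSpace, toMat_lastSum]
      rfl
  · rintro _ ⟨⟨u, v, N, β⟩, ⟨hobjp, hna, hnb, hpsd, hβ, hN, hu0, hv0⟩, rfl⟩
    dsimp only at hobjp hna hnb hpsd hβ hN hu0 hv0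
    -- Symmetry of `u_i` and `v_i` is not a separate constraint: it follows from semidefiniteness,
    -- from the form `w_i + w_iᵀ`, and from the zero initial values.
    have hu : ∀ i, ∃ x : SymSpace n, toMat x = u i := by
      intro i
      cases i using Fin.cases with
      | zero => exact ⟨0, by rw [hu0, map_zero]⟩
      | succ i => exact exists_toMat_eq (posSemidef_iff_real.1 (hpsd i)).1
    have hv : ∀ i, ∃ x : SymSpace n, toMat x = v i := by
      intro i
      cases i using Fin.cases with
      | zero => exact ⟨0, by rw [hv0, map_zero]⟩
      | succ i =>
        refine exists_toMat_eq ?_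
        rw [hN, Matrix.IsSymm, transpose_add, transpose_transpose, add_comm]
    choose U hU using hu
    choose V hV using hv
    have hU0 : U 0 = 0 := toMat_injective (by rw [hU, hu0, map_zero])
    have hV0 : V 0 = 0 := toMat_injective (by rw [hV, hv0, map_zero])
    have hpsd' : ∀ i : Fin (ℓ + 1), (toMat (U i.succ)).PosSemidef := fun i => by
      rw [hU]
      exact hpsd i
    have hlast : toMat (lastSum (U, V)) = SDPExtVar.lastSum ⟨u, v, N, β⟩ := by
      rw [toMat_lastSum]
      dsimp only
      rw [hU, hV]
      rfl
    refine ⟨(U, V), ⟨(hobj _).2 fun k => ?_, hU0, hV0, ?_, ?_⟩, ?_⟩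
    · rw [hlast]
      exact hobjp k
    · intro i hi
      obtain ⟨i, rfl⟩ := Fin.exists_succ_eq.2 hi
      refine ⟨mem_dualCone_psdCone.2 (hpsd' i), ?_⟩
      have hs := partialSum_mem_dualCone hU0 hpsd' i.succ
      refine (mem_tangentSpace_dualCone hs).2 ((forall_exposedFace_inner_eq_zero_iff hs).2
        ⟨N i, β i, ?_, ?_⟩)
      · rw [← hN, ← hV]
      · rw [map_sum, Finset.sum_congr rfl fun j _ => hU j]
        exact hβ i
    · intro i hi hil
      refine mem_nullL_combMap.2 ⟨fun k => ?_, ?_⟩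
      · dsimp only
        rw [map_add, hU, hV]
        exact hna i hi hil k
      · dsimp only
        rw [map_add, hU, hV]
        exact hnb i hi hil
    · dsimp only
      rw [inner_symSpace, hlast]

theorem image_sdpFeas (a : Fin m → SymSpace n) (b : SymSpace n) (c : Fin m → ℝ) :
    (fun x => ⟪(WithLp.toLp 2 c : EuclideanSpace ℝ (Fin m)), x⟫_ℝ) ''
        primalFeas (combMap a) b (psdCone n) =
      (fun x : Fin m → ℝ => ∑ k, c k * x k) '' sdpFeas (fun k => toMat (a k)) (toMat b) := by
  have hfeas : ∀ x : EuclideanSpace ℝ (Fin m), x ∈ primalFeas (combMap a) b (psdCone n) ↔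
      WithLp.ofLp x ∈ sdpFeas (fun k => toMat (a k)) (toMat b) := by
    intro x
    change (toMat (b - combMap a x)).PosSemidef ↔ _
    rw [combMap_apply, map_sub, map_sum]
    simp only [map_smul]
    rfl
  have hval : ∀ x : EuclideanSpace ℝ (Fin m),
      ⟪(WithLp.toLp 2 c : EuclideanSpace ℝ (Fin m)), x⟫_ℝ = ∑ k, c k * x k := by
    intro x
    rw [PiLp.inner_apply]
    refine Finset.sum_congr rfl fun k _ => ?_
    simp [mul_comm]
  apply subset_antisymm
  · rintro _ ⟨x, hx, rfl⟩
    exact ⟨x, (hfeas x).1 hx, (hval x).symm⟩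
  · rintro _ ⟨x, hx, rfl⟩
    exact ⟨WithLp.toLp 2 x, (hfeas _).2 hx, hval _⟩

theorem sdpExtStrongDuality_of_symSpace (a : Fin m → SymSpace n) (b : SymSpace n) (c : Fin m → ℝ)
    (hfeas : (sdpFeas (fun k => toMat (a k)) (toMat b)).Nonempty) {ℓ : ℕ}
    (hℓ : IsReductionBound (combMap a) b (psdCone n) ℓ) :
    SDPExtStrongDuality (fun k => toMat (a k)) (toMat b) c ℓ := by
  have hne : (primalFeas (combMap a) b (psdCone n)).Nonempty := by
    rw [← Set.image_nonempty, image_sdpFeas a b c, Set.image_nonempty]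
    exact hfeas
  obtain ⟨F, hF, -⟩ := existsUnique_isMinimalCone hne
  have h := hF.isSlackFace.strongDuality hne (WithLp.toLp 2 c)
    (hF.isSlackFace.dualCone_eq_image hasFacialSplitting_psdCone hℓ)
  exact h.congr (image_sdpFeas a b c) (image_sdpExtFeasible a b c ℓ)

theorem sdpExtStrongDuality (a : Fin m → Matrix (Fin n) (Fin n) ℝ) (b : Matrix (Fin n) (Fin n) ℝ)
    (c : Fin m → ℝ) (ha : ∀ k, (a k).IsSymm) (hb : b.IsSymm) (hind : LinearIndependent ℝ a)
    (hfeas : (sdpFeas a b).Nonempty) :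
    (b ∉ Submodule.span ℝ (Set.range a) →
        SDPExtStrongDuality a b c (min n (n * (n + 1) / 2 - m - 1))) ∧
      (b ∈ Submodule.span ℝ (Set.range a) →
        SDPExtStrongDuality a b c (min n (n * (n + 1) / 2 - m))) := by
  choose a' ha' using fun k => exists_toMat_eq (ha k)
  obtain ⟨b', rfl⟩ := exists_toMat_eq hb
  obtain rfl : (fun k => toMat (a' k)) = a := funext ha'
  have hind' : LinearIndependent ℝ a' := LinearIndependent.of_comp toMat hind
  have hle := finrank_nullL_combMap_add_le a' b'
  constructor
  · intro hbspan
    refine sdpExtStrongDuality_of_symSpace a' b' c hfeas (isReductionBound_min ?_)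
    have hb' : b' ∉ Submodule.span ℝ (Set.range a') := by
      refine fun h => hbspan ?_
      have h2 := Submodule.mem_map_of_mem (f := toMat) h
      rwa [Submodule.map_span, ← Set.range_comp] at h2
    -- `b'` and the `a' k` span `m + 1` dimensions orthogonal to `L`, so the natural-number
    -- subtraction in `ℓ` does not truncate and bounds `dim L`.
    have hcons : LinearIndependent ℝ (Fin.cons b' a' : Fin (m + 1) → SymSpace n) :=
      linearIndependent_finCons.2 ⟨hind', hb'⟩
    have hrank := finrank_span_eq_card hcons
    rw [Fin.range_cons, Fintype.card_fin] at hrank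
    omega
  · intro _
    refine sdpExtStrongDuality_of_symSpace a' b' c hfeas (isReductionBound_min ?_)
    have hrank := finrank_span_eq_card hind'
    rw [Fintype.card_fin] at hrank
    have hmono := Submodule.finrank_mono (Submodule.span_mono (R := ℝ)
      (Set.subset_insert b' (Set.range a')))
    omega

end SDP

end ConicDual

theorem corollary1 :
    (∀ (X Y : Type*) [NormedAddCommGroup X] [InnerProductSpace ℝ X] [FiniteDimensional ℝ X]
        [NormedAddCommGroup Y] [InnerProductSpace ℝ Y] [FiniteDimensional ℝ Y]
        (A : X →ₗ[ℝ] Y) (b : Y) (K : ProperCone ℝ Y),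
        ConicDual.IsNice K → (ConicDual.primalFeas A b K).Nonempty →
        (∃! F : Set Y, ConicDual.IsMinimalCone A b K F) ∧
        (∀ F : Set Y, ConicDual.IsMinimalCone A b K F →
          ConicDual.dualCone F =
            {y | ∃ p ∈ ConicDual.extNice A b K (ConicDual.ell A b K), y = ConicDual.lastSum p}) ∧
        (∀ c : X, ConicDual.StrongDuality
          (ConicDual.primalFeas A b K) (fun x => ⟪c, x⟫_ℝ)
          (ConicDual.extDualFeas A b c K (ConicDual.ell A b K))
          (fun p => ⟪b, ConicDual.lastSum p⟫_ℝ))) ∧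
    (∀ (n m : ℕ) (a : Fin m → Matrix (Fin n) (Fin n) ℝ) (b : Matrix (Fin n) (Fin n) ℝ)
        (c : Fin m → ℝ),
        (∀ k, (a k).IsSymm) → b.IsSymm → LinearIndependent ℝ a →
        (ConicDual.sdpFeas a b).Nonempty →
        (b ∉ Submodule.span ℝ (Set.range a) →
          ConicDual.SDPExtStrongDuality a b c (min n (n * (n + 1) / 2 - m - 1))) ∧
        (b ∈ Submodule.span ℝ (Set.range a) →
          ConicDual.SDPExtStrongDuality a b c (min n (n * (n + 1) / 2 - m)))) := by
  exact ⟨fun X Y _ _ _ _ _ _ A b K hK hfeas => ConicDual.extendedDual_of_isNice A b K hK hfeas,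
    fun n m a b c ha hb hind hfeas => ConicDual.sdpExtStrongDuality a b c ha hb hind hfeas⟩
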